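/- Let $\mathbb F_q$ be a finite field with $q$ elements, let $X$ be a nonsingular (irreducible) projective curve over $\mathbb F_q$, let $\infty$ be a closed point of $X$, and let $A$ be the ring of functions on $X$ that are regular everywhere except possibly at $\infty$. Let $K$ be a finitely generated field extension of $\mathbb F_q$ and $i:A\to K$ a morphism of $\mathbb F_q$-algebras. Let $K\{\tau\}$ be the ring of polynomials in $\tau$ with coefficients in $K$, where $\tau c=c^q\tau$; its elements act on every extension of $K$ by $\tau(x)=x^q$. Let $\phi:A\to K\{\tau\}$, $a\mapsto\phi_a$, be a Drinfeld module, i.e. a ring homomorphism such that the coefficient of $\tau^0$ in $\phi_a$ is $i(a)$ for all $a\in A$, and suppose that $\phi$ has finite characteristic, i.e. $\ker i\neq\{0\}$. Fix a normal projective variety $V\subseteq\mathbb P^M$ with function field $K$ over a finite field containing $\mathbb F_q$. Let $M_K$ be the set of valuations of $K$ that belong to the irreducible divisors of $V$, and for $v\in M_K$ let $\deg(v)$ be the degree in $\mathbb P^M$ of its divisor, that is, the intersection number of the divisor with a generic linear subspace of complementary dimension. For a finite extension $L/K$ let $M_L$ be the set of valuations of $L$ that belong to the irreducible divisors of the normalization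 of $V$ in $L$. All valuations are normalized to have value group $\mathbb Z$. For $w\in M_L$ above $v\in M_K$, let $e(w|v)$ and $f(w|v)$ be the ramification index and the relative residue degree, and for $x\in L$ define the local height $$\hat h_w(x)=-\frac{\deg(v)f(w|v)}{[L:K]}\lim_{n\to\infty}\frac{\min\{0,w(\phi_{a^n}(x))\}}{\deg\phi_{a^n}},$$ where $a\in A$ is any nonconstant element and $\deg\phi_{a^n}$ is the degree of $\phi_{a^n}(x)$ as a polynomial in $x$. Then there exist $C>0$ and $k\ge 1$, depending only on $\phi$ (and on the fixed $K$ and $V$), such that for every $x\in K^{\mathrm{alg}}$, with $d=[K(x):K]$, and every $v\in M_{K(x)}$ with $\hat h_v(x)>0$, $$\hat h_v(x)\ge\frac{C}{e(v|v_0)^{k-1}\,d},$$ where $v_0\in M_K$ is the place of $K$ below $v$. The constants $C$ and $k$ do not depend on the choice of the nonconstant element $a\in A$ that is used to compute the local heights. -/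

import Mathlib

noncomputable section

namespace DrinfeldHeight

open Filter Topology

/-! ## Finite fields of constants inside valuation rings -/

/-- Every valuation subring of a field contains every finite subfield. -/
theorem algebraMap_mem_of_finite (k : Type*) [Field k] [Finite k] {E : Type*} [Field E]
    [Algebra k E] (O : ValuationSubring E) (c : k) : algebraMap k E c ∈ O := by
  by_cases hc : c = 0
  · simp [hc, O.zero_mem]
  · have hfin : IsOfFinOrder (Units.mk0 c hc) := isOfFinOrder_of_finite _
    obtain ⟨n, hn, h1⟩ := hfin.exists_pow_eq_one
    have h2 : c ^ n = 1 := by simpa using congrArg (fun u : kˣ => (u : k)) h1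
    have h3 : (O.valuation (algebraMap k E c)) ^ n = 1 := by
      rw [← map_pow, ← map_pow, h2, map_one, map_one]
    rw [← O.valuation_le_one_iff]
    exact le_of_not_gt fun h => (one_lt_pow₀ h hn.ne').ne' h3

/-! ## The ring `A` of functions regular outside `∞`

A nonsingular projective curve over a finite field `Fq` is given by its function field `F`; its
closed points are the valuation rings `O ≠ F` of `F` (they automatically contain `Fq`), and the
functions regular at the point are the elements of `O`. -/

/-- The functions in `F` that are regular at all closed points except possibly at `infty`. -/
def regularAwayFrom (Fq : Type*) [Field Fq] [Finite Fq] {F : Type*} [Field F] [Algebra Fq F]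
    (infty : ValuationSubring F) : Subalgebra Fq F where
  carrier := {f | ∀ O : ValuationSubring F, O ≠ ⊤ → O ≠ infty → f ∈ O}
  mul_mem' hf hg O h1 h2 := O.mul_mem _ _ (hf O h1 h2) (hg O h1 h2)
  add_mem' hf hg O h1 h2 := O.add_mem _ _ (hf O h1 h2) (hg O h1 h2)
  algebraMap_mem' c O _ _ := algebraMap_mem_of_finite Fq O c

/-! ## Twisted polynomials and Drinfeld modules -/

/-- The action of `ℕ` on an extension `K` of the finite field `Fq` by iterates of the Frobenius
`x ↦ x ^ q`, where `q` is the cardinality of `Fq`. -/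
@[reducible]
def frobeniusAction (Fq : Type*) [Field Fq] [Finite Fq] (K : Type*) [Field K] [Algebra Fq K] :
    MulSemiringAction (Multiplicative ℕ) K where
  smul n x := x ^ (Nat.card Fq ^ n.toAdd)
  one_smul x := by
    change x ^ (Nat.card Fq ^ 0) = x
    simp
  mul_smul m n x := by
    change x ^ (Nat.card Fq ^ (m.toAdd + n.toAdd)) =
      (x ^ (Nat.card Fq ^ n.toAdd)) ^ (Nat.card Fq ^ m.toAdd)
    rw [← pow_mul, ← pow_add, add_comm]
  smul_zero n := by
    change (0 : K) ^ (Nat.card Fq ^ n.toAdd) = 0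
    exact zero_pow (pow_ne_zero _ Nat.card_pos.ne')
  smul_one n := one_pow _
  smul_mul n x y := mul_pow _ _ _
  smul_add n x y := by
    change (x + y) ^ (Nat.card Fq ^ n.toAdd) =
      x ^ (Nat.card Fq ^ n.toAdd) + y ^ (Nat.card Fq ^ n.toAdd)
    have := Fintype.ofFinite Fq
    obtain ⟨m, hp, hm⟩ := FiniteField.card Fq (ringChar Fq)
    have : Fact (ringChar Fq).Prime := ⟨hp⟩
    have : CharP K (ringChar Fq) := charP_of_injective_algebraMap (algebraMap Fq K).injective _
    rw [Nat.card_eq_fintype_card, hm, ← pow_mul]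
    exact add_pow_char_pow ..

set_option linter.unusedVariables false in
/-- The ring `K{τ}` of polynomials in `τ` with coefficients in `K`, where `τ c = c ^ q τ`. -/
def TwistedPoly (Fq : Type*) [Field Fq] [Finite Fq] (K : Type*) [Field K] [Algebra Fq K] :
    Type _ :=
  SkewPolynomial K

namespace TwistedPoly

variable {Fq : Type*} [Field Fq] [Finite Fq] {K : Type*} [Field K] [Algebra Fq K]

instance : Ring (TwistedPoly Fq K) :=
  letI := frobeniusAction Fq K
  inferInstanceAs (Ring (SkewPolynomial K))

/-- The coefficient of `τ ^ n`. -/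
def coeff (f : TwistedPoly Fq K) (n : ℕ) : K := SkewPolynomial.coeff f n

/-- The set of `n` such that `τ ^ n` has a nonzero coefficient. -/
def support (f : TwistedPoly Fq K) : Finset ℕ := SkewPolynomial.support f

/-- The value at `x` of the additive polynomial `∑ aᵢ x ^ (q ^ i)` given by `∑ aᵢ τ ^ i`. -/
def eval {L : Type*} [Field L] [Algebra K L] (f : TwistedPoly Fq K) (x : L) : L :=
  ∑ i ∈ f.support, algebraMap K L (f.coeff i) * x ^ (Nat.card Fq ^ i)

/-- The degree in `x` of the additive polynomial `∑ aᵢ x ^ (q ^ i)`. -/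
def degree (f : TwistedPoly Fq K) : ℕ := Nat.card Fq ^ f.support.sup id

end TwistedPoly

/-- A Drinfeld module over `K`, for a structure morphism `i : A → K`. -/
structure DrinfeldModule (Fq : Type*) [Field Fq] [Finite Fq] {A : Type*} [CommRing A]
    [Algebra Fq A] {K : Type*} [Field K] [Algebra Fq K] (i : A →ₐ[Fq] K) where
  /-- the ring homomorphism `a ↦ φ_a` -/
  toRingHom : A →+* TwistedPoly Fq K
  /-- the coefficient of `τ ^ 0` in `φ_a` is `i a` -/
  coeff_zero : ∀ a, (toRingHom a).coeff 0 = i a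

/-! ## Normal projective models and their divisors

A projective variety `V ⊆ ℙ^M` over `k`, whose function field is identified with `K`, is the
closure of the `K`-point given by the homogeneous coordinates of its generic point. -/

/-- The coordinate ring of the affine chart of `V` where the `j`-th coordinate does not vanish. -/
def chart (k : Type*) [Field k] {K : Type*} [Field K] [Algebra k K] {M : ℕ}
    (coord : Fin (M + 1) → K) (j : Fin (M + 1)) : Subalgebra k K :=
  Algebra.adjoin k (Set.range fun i => coord i / coord j)

/-- A normal projective variety over `k` in `ℙ^M` with function field `K`. -/
structure ProjectiveModel (k : Type*) [Field k] (K : Type*) [Field K] [Algebra k K] (M : ℕ) where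
  /-- homogeneous coordinates of the generic point -/
  coord : Fin (M + 1) → K
  coord_ne_zero : coord ≠ 0
  /-- the function field of the variety is `K` -/
  generates : IntermediateField.adjoin k {y : K | ∃ i j, y = coord i / coord j} = ⊤
  /-- the variety is normal -/
  normal : ∀ j, coord j ≠ 0 → IsIntegrallyClosed (chart k coord j)

/-- The center of a valuation ring `w ⊇ B` on the affine scheme `Spec B`. -/
def center {L : Type*} [Field L] (w : ValuationSubring L) (B : Subring L)
    (h : B ≤ w.toSubring) : Ideal B :=
  (IsLocalRing.maximalIdeal w).comap (B.subtype.codRestrict w.toSubring fun b => h b.2)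

/-- The projective degree in `ℙ^M` of an integral closed subvariety `Z` over `k` of dimension `n`:
the scheme-theoretic intersection number of `Z` with the generic linear subspace of codimension
`n`. This subspace is defined by `n` linear forms whose coefficients are independent indeterminates,
over the field generated by the latter. Here `I` is the ideal of a nonempty affine part
`Z ∩ {X_j ≠ 0}`, written in the coordinates with `X_j = 1` (so `X_j - 1 ∈ I`); the rest of `Z` has
dimension less than `n`, so that the generic linear subspace does not meet it. -/
def genericSectionDegree {k : Type*} [Field k] {M : ℕ}
    (I : Ideal (MvPolynomial (Fin (M + 1)) k)) : ℕ :=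
  let n : ℕ := (Algebra.trdeg k (MvPolynomial (Fin (M + 1)) k ⧸ I)).toNat
  let P := MvPolynomial (Fin n × Fin (M + 1)) k
  let U := FractionRing P
  let u : Fin n → Fin (M + 1) → U := fun a j => algebraMap P U (MvPolynomial.X (a, j))
  Module.finrank U (MvPolynomial (Fin (M + 1)) U ⧸
    (I.map (MvPolynomial.map (algebraMap k U)) ⊔
      Ideal.span (Set.range fun a : Fin n =>
        ∑ j, MvPolynomial.C (u a j) * (MvPolynomial.X j : MvPolynomial (Fin (M + 1)) U))))

namespace ProjectiveModel

variable {k : Type*} [Field k] {K : Type*} [Field K] [Algebra k K] {M : ℕ}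

/-- The coordinate ring of the part above the `j`-th chart of the normalization in `L`. -/
def normalizedChart (V : ProjectiveModel k K M) (L : Type*) [Field L] [Algebra K L]
    (j : Fin (M + 1)) : Subring L :=
  (integralClosure (chart k V.coord j) L).toSubring

/-- The set `M_L` of the valuations of `L` (given by their valuation rings) that belong to the
irreducible divisors of the normalization `W` of `V` in `L`: the valuation rings of `L` whose
center on `W` is a point of codimension one. -/
def divisors (V : ProjectiveModel k K M) (L : Type*) [Field L] [Algebra K L] :
    Set (ValuationSubring L) :=
  {w | ∃ j, V.coord j ≠ 0 ∧ ∃ h : V.normalizedChart L j ≤ w.toSubring,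
    (center w (V.normalizedChart L j) h).height = 1}

/-- Every valuation ring of `K` contains the coordinate ring of some chart. -/
theorem exists_chart [Finite k] (V : ProjectiveModel k K M) (v : ValuationSubring K) :
    ∃ j, V.coord j ≠ 0 ∧ (chart k V.coord j).toSubring ≤ v.toSubring := by
  obtain ⟨j, -, hj⟩ := Finset.exists_max_image Finset.univ (fun i => v.valuation (V.coord i))
    Finset.univ_nonempty
  have hj0 : V.coord j ≠ 0 := by
    intro h0
    apply V.coord_ne_zero
    funext i
    have := hj i (Finset.mem_univ i)
    simpa [h0] using this
  refine ⟨j, hj0, ?_⟩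
  let S : Subalgebra k K :=
    { v.toSubring with algebraMap_mem' := fun c => algebraMap_mem_of_finite k v c }
  have hS : chart k V.coord j ≤ S := by
    refine Algebra.adjoin_le ?_
    rintro _ ⟨i, rfl⟩
    change V.coord i / V.coord j ∈ v
    rw [← v.valuation_le_one_iff, map_div₀]
    exact div_le_one_of_le₀ (hj i (Finset.mem_univ i)) zero_le
  exact fun y hy => hS hy

/-- The ideal of the center of `v` on the `j`-th chart, in the polynomial ring that maps onto the
coordinate ring of the chart. -/
def centerIdeal (V : ProjectiveModel k K M) (v : ValuationSubring K) (j : Fin (M + 1))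
    (h : (chart k V.coord j).toSubring ≤ v.toSubring) : Ideal (MvPolynomial (Fin (M + 1)) k) :=
  (center v (chart k V.coord j).toSubring h).comap
    (MvPolynomial.aeval fun i : Fin (M + 1) =>
      (⟨V.coord i / V.coord j, Algebra.subset_adjoin ⟨i, rfl⟩⟩ : chart k V.coord j)).toRingHom

/-- The projective degree in `ℙ^M` of the irreducible divisor of `V` belonging to `v`. -/
def degree [Finite k] (V : ProjectiveModel k K M) (v : ValuationSubring K) : ℕ :=
  genericSectionDegree
    (V.centerIdeal v (V.exists_chart v).choose (V.exists_chart v).choose_spec.2)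

end ProjectiveModel

/-! ## Normalized valuations, ramification and local heights -/

/-- The order of an element of a discrete valuation ring (with the value `0` at `0`). -/
def ordOfMem {L : Type*} [Field L] (w : ValuationSubring L) (y : w) : ℕ :=
  sSup {n : ℕ | y ∈ IsLocalRing.maximalIdeal w ^ n}

open Classical in
/-- `min {0, w(y)}` for the normalized (`ℤ`-valued) valuation `w` of a discrete valuation ring:
it is `0` on the ring, in particular at `y = 0`, and the negative of the order of `y⁻¹` outside. -/
def truncatedOrd {L : Type*} [Field L] (w : ValuationSubring L) (y : L) : ℤ :=
  if h : y ∈ w then 0 else -(ordOfMem w ⟨y⁻¹, (w.mem_or_inv_mem y).resolve_left h⟩ : ℤ)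

section Extension

variable (K : Type*) [Field K] {L : Type*} [Field L] [Algebra K L]

/-- The valuation ring of `K` below the valuation ring `w` of `L`. -/
def below (w : ValuationSubring L) : ValuationSubring K := w.comap (algebraMap K L)

/-- The inclusion of the valuation ring below `w` into `w`. -/
@[reducible]
def belowAlgebra (w : ValuationSubring L) : Algebra (below K w) w :=
  (((algebraMap K L).comp (below K w).subtype).codRestrict w.toSubring fun y => y.2).toAlgebra

/-- The ramification index of `w` over the valuation below it. -/
def ramificationIndex (w : ValuationSubring L) : ℕ :=
  letI := belowAlgebra K w
  Ideal.ramificationIdx' (IsLocalRing.maximalIdeal (below K w)) (IsLocalRing.maximalIdeal w)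

/-- The relative degree of the residue field of `w` over the one of the valuation below it. -/
def residueDegree (w : ValuationSubring L) : ℕ :=
  letI := belowAlgebra K w
  Ideal.inertiaDeg' (IsLocalRing.maximalIdeal (below K w)) (IsLocalRing.maximalIdeal w)

end Extension

namespace DrinfeldModule

variable {Fq : Type*} [Field Fq] [Finite Fq] {A : Type*} [CommRing A] [Algebra Fq A]
  {K : Type*} [Field K] [Algebra Fq K] {i : A →ₐ[Fq] K}

/-- `V_w(x) = lim_n min {0, w(φ_{a ^ n}(x))} / deg φ_{a ^ n}`. -/
def unweightedLocalHeight (φ : DrinfeldModule Fq i) (a : A) {L : Type*} [Field L] [Algebra K L]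
    (w : ValuationSubring L) (x : L) : ℝ :=
  limUnder atTop fun n : ℕ =>
    (truncatedOrd w ((φ.toRingHom (a ^ n)).eval x) : ℝ) / ((φ.toRingHom (a ^ n)).degree : ℝ)

/-- The local height `- deg(v) f(w|v) / [L : K] * V_w(x)` at the place `w` of `L`, where `v` is the
place of `K` below `w`, computed with the element `a` of `A`. -/
def localHeight (φ : DrinfeldModule Fq i) (a : A) {k : Type*} [Field k] [Finite k] [Algebra k K]
    {M : ℕ} (V : ProjectiveModel k K M) {L : Type*} [Field L] [Algebra K L]
    (w : ValuationSubring L) (x : L) : ℝ :=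
  -((V.degree (below K w) : ℝ) * (residueDegree K w : ℝ) / (Module.finrank K L : ℝ)) *
    φ.unweightedLocalHeight a w x

end DrinfeldModule

end DrinfeldHeight

end

/-! Choose `t ≠ 0` with `i t = 0`. Finite characteristic enters through `f = φ_t`: it has no `τ ^ 0`
term, so every monomial of `f(y) = ∑ a_j y ^ (q ^ j)` has degree at least `q`. Let `D = deg f`. If
`φ` is injective, Tate's limit gives a canonical height `h` with `h (f y) = D * h y` that stays
within `c = O(e)` of `max {0, -w(y)}`, where `e` is the ramification index. Each `φ_a` commutes with
`φ_t`, and its degree exceeds one when `a` is nonconstant. Its own limit is therefore again `h`,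
which is why the constants do not depend on `a`.

Suppose `h x > 0`. If along the orbit of `z` the value of `f` is always as large as its largest
monomial, then the sizes `-w` increase, by integer gaps that grow at least by the factor `q` in each
step. After about `log_q e` steps the size exceeds `c + 1` and the height is at least `1`. The
obstacle is cancellation. Two monomials of `f` balance at only one value of `w(y)`, and there the
cancelling elements reduce to roots of one polynomial of degree at most `deg f` over the residue
field. Avoiding them costs a bounded number of `Fq`-dimensions per step
(`exists_subspace_isDominated`). The span of `x, f x, ..., f^N x` with `N` proportional to the
number of steps thus contains a suitable `z ≠ 0`, and the ultrametric inequality gives `0 < h z < D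
^ (N + 1) * h x`. Hence `1 ≤ D ^ O(log e + 1) * h x`, a bound polynomial in `e`
(`IsCanonicalHeight.one_le_pow_mul`, `IsCanonicalHeight.div_pow_le`).

For uniformity over all places: the nonzero coefficients of `φ_t` are units at all but finitely many
divisors of `V`, so their orders are bounded on `M_K`, and by a multiple of `e` above
(`ProjectiveModel.exists_valuation`). The weight of a place with positive height is at least `1 /
d`. If `φ` is not injective, every `φ_a` is zero or a root of unity and the unweighted heights are
integers. -/

namespace DrinfeldHeight

open Filter Topology

/-! ### Additive polynomials without cancellation on subspaces of bounded codimension -/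

section Domination

variable {Fq : Type*} [Field Fq] [Finite Fq] {L : Type*} [Field L] [Algebra Fq L]
  {Γ : Type*} [LinearOrderedCommGroupWithZero Γ]

/-- Nonzero elements of a finite subfield are units for every valuation. -/
theorem valuation_algebraMap_eq_one (v : Valuation L Γ) {c : Fq} (hc : c ≠ 0) :
    v (algebraMap Fq L c) = 1 := by
  have hfin : IsOfFinOrder (Units.mk0 c hc) := isOfFinOrder_of_finite _
  obtain ⟨n, hn, h1⟩ := hfin.exists_pow_eq_one
  have h2 : c ^ n = 1 := by simpa using congrArg (fun u : Fqˣ => (u : Fq)) h1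
  have h3 : (v (algebraMap Fq L c)) ^ n = 1 := by
    rw [← map_pow, ← map_pow, h2, map_one, map_one]
  exact (pow_eq_one_iff_of_nonneg zero_le hn.ne').mp h3

theorem valuation_smul_le (v : Valuation L Γ) (c : Fq) (y : L) : v (c • y) ≤ v y := by
  by_cases hc : c = 0
  · simp [hc]
  · rw [Algebra.smul_def, map_mul, valuation_algebraMap_eq_one v hc, one_mul]

/-- The elements of `W` of valuation at most `s`. -/
def ballLE (v : Valuation L Γ) (W : Submodule Fq L) (s : Γ) : Submodule Fq L where
  carrier := {y | y ∈ W ∧ v y ≤ s}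
  zero_mem' := ⟨W.zero_mem, by simp⟩
  add_mem' h h' := ⟨W.add_mem h.1 h'.1, v.map_add_le h.2 h'.2⟩
  smul_mem' c _ h := ⟨W.smul_mem c h.1, (valuation_smul_le v c _).trans h.2⟩

/-- The elements of `W` of valuation less than `s`. -/
def ballLT (v : Valuation L Γ) (W : Submodule Fq L) {s : Γ} (hs : s ≠ 0) : Submodule Fq L where
  carrier := {y | y ∈ W ∧ v y < s}
  zero_mem' := ⟨W.zero_mem, by simpa using zero_lt_iff.mpr hs⟩
  add_mem' h h' := ⟨W.add_mem h.1 h'.1, v.map_add_lt h.2 h'.2⟩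
  smul_mem' c _ h := ⟨W.smul_mem c h.1, (valuation_smul_le v c _).trans_lt h.2⟩

/-- `f y` has the valuation of the largest monomial. -/
def IsDominated (v : Valuation L Γ) (S : Finset ℕ) (a : ℕ → L) (q : ℕ) (f : L → L) (y : L) : Prop :=
  ∀ i ∈ S, v (a i * y ^ q ^ i) ≤ v (f y)

open Polynomial in
/-- Only boundedly many directions of elements of size `v y₀` have a cancellation in `f`. -/
theorem finrank_cancelling_le (v : Valuation L Γ) (S : Finset ℕ) (a : ℕ → L) (f : L →ₗ[Fq] L)
    (hf : ∀ y, f y = ∑ i ∈ S, a i * y ^ Nat.card Fq ^ i) (W : Submodule Fq L)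
    [FiniteDimensional Fq W] {y₀ : L} (hy₀ : v y₀ ≠ 0) {i₀ : ℕ} (hi₀ : i₀ ∈ S)
    (hm : v (a i₀ * y₀ ^ Nat.card Fq ^ i₀) ≠ 0)
    (hmax : ∀ i ∈ S, v (a i * y₀ ^ Nat.card Fq ^ i) ≤ v (a i₀ * y₀ ^ Nat.card Fq ^ i₀)) :
    Module.finrank Fq (ballLE v W (v y₀) ⊓ (ballLT v ⊤ hm).comap f : Submodule Fq L) ≤
      Module.finrank Fq (ballLT v W hy₀) + S.sup id := by
  classical
  set q := Nat.card Fq with hq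
  have hq1 : 1 < q := Finite.one_lt_card
  set B : Submodule Fq L := ballLE v W (v y₀) ⊓ (ballLT v ⊤ hm).comap f with hB
  set U : Submodule Fq L := ballLT v W hy₀ with hU
  have hBW : B ≤ W := fun y hy => hy.1.1
  have hUW : U ≤ W := fun y hy => hy.1
  have : FiniteDimensional Fq B := Submodule.finiteDimensional_of_le hBW
  have : FiniteDimensional Fq U := Submodule.finiteDimensional_of_le hUW
  have : Finite B := Module.finite_of_finite Fq
  have : Finite U := Module.finite_of_finite Fq
  have hy0 : y₀ ≠ 0 := v.ne_zero_iff.mp hy₀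
  -- Divide by `y₀` and reduce to the residue field. The image of `B` is an additive group of roots
  -- of a fixed polynomial, and the kernel consists of elements smaller than `y₀`.
  let O := v.valuationSubring
  let κ := IsLocalRing.ResidueField O
  have hmemO : ∀ y : B, (y : L) / y₀ ∈ O := fun y => by
    rw [Valuation.mem_valuationSubring_iff, map_div₀]
    exact div_le_one_of_le₀ y.2.1.2 zero_le
  let g : B →+ κ :=
    { toFun := fun y => IsLocalRing.residue O ⟨(y : L) / y₀, hmemO y⟩
      map_zero' := by
        convert map_zero (IsLocalRing.residue O)
        simp
      map_add' := fun y z => by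
        rw [← map_add]
        congr 1
        ext; simp [add_div] }
  set M := a i₀ * y₀ ^ q ^ i₀ with hM
  have hM0 : M ≠ 0 := v.ne_zero_iff.mp hm
  have hco : ∀ i ∈ S, a i * y₀ ^ q ^ i / M ∈ O := fun i hi => by
    rw [Valuation.mem_valuationSubring_iff, map_div₀]
    exact div_le_one_of_le₀ (hmax i hi) zero_le
  let co : ℕ → O := fun i => if h : i ∈ S then ⟨a i * y₀ ^ q ^ i / M, hco i h⟩ else 0
  -- The reduction of `f (y₀ X) / M`, where `M` is a largest monomial at `y₀`. Its coefficient at `q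
  -- ^ i₀` is `1`, and an element of `B` reduces to a root because `v (f y) < v M`.
  let P : κ[X] := ∑ i ∈ S, C (IsLocalRing.residue O (co i)) * X ^ q ^ i
  have hinj : Function.Injective fun i : ℕ => q ^ i := Nat.pow_right_injective hq1
  have hP0 : P ≠ 0 := by
    intro h
    have h1 : P.coeff (q ^ i₀) = 1 := by
      simp only [P, finsetSum_coeff, coeff_C_mul, coeff_X_pow]
      rw [Finset.sum_eq_single i₀]
      · have : co i₀ = 1 := by
          ext
          simp only [co, dif_pos hi₀]
          exact div_self hM0
        simp [this]
      · intro j _ hj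
        rw [if_neg (fun h => hj (hinj h).symm), mul_zero]
      · exact fun h => absurd hi₀ h
    rw [h, coeff_zero] at h1
    exact zero_ne_one h1
  have hPdeg : P.natDegree ≤ q ^ S.sup id := by
    refine natDegree_sum_le_of_forall_le _ _ fun i hi => ?_
    refine (natDegree_C_mul_X_pow_le _ _).trans ?_
    exact Nat.pow_le_pow_right hq1.le (Finset.le_sup (f := id) hi)
  have hroot : ∀ y : B, g y ∈ P.roots := by
    intro y
    rw [mem_roots hP0, IsRoot.def]
    simp only [P, eval_finsetSum, eval_mul, eval_C, eval_pow, eval_X]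
    have : ∑ i ∈ S, IsLocalRing.residue O (co i) * g y ^ q ^ i =
        IsLocalRing.residue O (∑ i ∈ S, co i * (⟨(y : L) / y₀, hmemO y⟩ : O) ^ q ^ i) := by
      rw [map_sum]
      refine Finset.sum_congr rfl fun i _ => ?_
      rw [map_mul, map_pow]; rfl
    rw [this, IsLocalRing.residue_eq_zero_iff]
    have hval : ((∑ i ∈ S, co i * (⟨(y : L) / y₀, hmemO y⟩ : O) ^ q ^ i : O) : L) = f y / M := by
      rw [hf, Finset.sum_div, AddSubmonoidClass.coe_finsetSum]
      refine Finset.sum_congr rfl fun i hi => ?_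
      simp only [co, dif_pos hi]
      push_cast
      rw [div_pow]
      field_simp
    rw [Valuation.mem_maximalIdeal_iff, hval, map_div₀]
    have h2 : v (f y) < v M := y.2.2.2
    exact (div_lt_one₀ (zero_lt_iff.mpr hm)).mpr h2
  have hrange : Nat.card g.range ≤ q ^ S.sup id := by
    have h1 : (g.range : Set κ) ⊆ (P.roots.toFinset : Set κ) := by
      rintro _ ⟨y, rfl⟩
      simpa using hroot y
    calc Nat.card g.range = (g.range : Set κ).ncard := rfl
      _ ≤ (P.roots.toFinset : Set κ).ncard := Set.ncard_le_ncard h1 (Finset.finite_toSet _)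
      _ = P.roots.toFinset.card := Set.ncard_coe_finset _
      _ ≤ Multiset.card P.roots := Multiset.toFinset_card_le _
      _ ≤ P.natDegree := P.card_roots'
      _ ≤ _ := hPdeg
  have hker : Nat.card g.ker ≤ Nat.card U := by
    refine Nat.card_le_card_of_injective (fun y : g.ker => (⟨y.1.1, ?_⟩ : U)) ?_
    · have h1 : g y.1 = 0 := y.2
      change IsLocalRing.residue O _ = 0 at h1
      rw [IsLocalRing.residue_eq_zero_iff, Valuation.mem_maximalIdeal_iff, map_div₀,
        div_lt_one₀ (zero_lt_iff.mpr hy₀)] at h1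
      exact ⟨y.1.2.1.1, h1⟩
    · exact fun y z h => Subtype.ext (Subtype.ext (congrArg (fun u : U => (u : L)) h))
  have hcard : Nat.card B = Nat.card g.ker * Nat.card g.range := by
    rw [← AddSubgroup.card_mul_index g.ker, AddSubgroup.index_ker]
  have h3 : Nat.card B ≤ Nat.card U * q ^ S.sup id := by
    rw [hcard]; exact Nat.mul_le_mul hker hrange
  rw [Module.natCard_eq_pow_finrank (K := Fq) (V := B),
    Module.natCard_eq_pow_finrank (K := Fq) (V := U), ← hq, ← pow_add] at h3
  exact (Nat.pow_le_pow_iff_right hq1).mp h3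

/-- On a subspace of bounded codimension there is no cancellation between the `i`-th and the
`j`-th monomial of `f`. -/
theorem exists_subspace_no_pair_cancellation (v : Valuation L Γ) (S : Finset ℕ) (a : ℕ → L)
    (ha : ∀ i ∈ S, a i ≠ 0) (f : L →ₗ[Fq] L)
    (hf : ∀ y, f y = ∑ i ∈ S, a i * y ^ Nat.card Fq ^ i) {i j : ℕ} (hi : i ∈ S) (hj : j ∈ S)
    (hij : i < j) (W : Submodule Fq L) [FiniteDimensional Fq W] :
    ∃ W' ≤ W, Module.finrank Fq W ≤ Module.finrank Fq W' + S.sup id ∧ ∀ y ∈ W', y ≠ 0 →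
      v (a i * y ^ Nat.card Fq ^ i) = v (a j * y ^ Nat.card Fq ^ j) →
      (∀ k ∈ S, v (a k * y ^ Nat.card Fq ^ k) ≤ v (a i * y ^ Nat.card Fq ^ i)) →
      IsDominated v S a (Nat.card Fq) f y := by
  set q := Nat.card Fq with hq
  have hq1 : 1 < q := Finite.one_lt_card
  by_cases h : ∃ y₀ ∈ W, y₀ ≠ 0 ∧ v (a i * y₀ ^ q ^ i) = v (a j * y₀ ^ q ^ j) ∧
      ∀ k ∈ S, v (a k * y₀ ^ q ^ k) ≤ v (a i * y₀ ^ q ^ i)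
  swap
  · exact ⟨W, le_rfl, Nat.le_add_right _ _, fun y hy hy0 h1 h2 => (h ⟨y, hy, hy0, h1, h2⟩).elim⟩
  obtain ⟨y₀, hy₀W, hy₀, heq, hmax⟩ := h
  have hvy₀ : v y₀ ≠ 0 := v.ne_zero_iff.mpr hy₀
  have hm : v (a i * y₀ ^ q ^ i) ≠ 0 := v.ne_zero_iff.mpr (mul_ne_zero (ha i hi) (pow_ne_zero _ hy₀))
  have hB := finrank_cancelling_le v S a f hf W hvy₀ hi hm hmax
  set B : Submodule Fq L := ballLE v W (v y₀) ⊓ (ballLT v ⊤ hm).comap f with hBdef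
  set U : Submodule Fq L := ballLT v W hvy₀ with hUdef
  have hBW : B ≤ W := fun y hy => hy.1.1
  have hUB : U ≤ B := by
    refine fun y hy => ⟨⟨hy.1, hy.2.le⟩, Submodule.mem_top, ?_⟩
    have hy2 : v y < v y₀ := hy.2
    rw [hf]
    refine v.map_sum_lt hm fun k hk => lt_of_lt_of_le ?_ (hmax k hk)
    rw [map_mul, map_mul, map_pow, map_pow]
    exact mul_lt_mul_of_pos_left (pow_lt_pow_left₀ hy2 zero_le (pow_ne_zero _ (by omega)))
      (zero_lt_iff.mpr (v.ne_zero_iff.mpr (ha k hk)))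
  -- By the modular law `U ⊔ C ⊓ W` meets `B` exactly in `U`, so it avoids cancellation at the size
  -- of `y₀`. Its codimension in `W` is `dim B - dim U`, which the previous lemma bounds.
  obtain ⟨C, hC⟩ := Submodule.exists_isCompl B
  -- Two monomials of different degrees have equal valuation for only one value of `v y`, so a
  -- single `y₀` represents all critical elements.
  have hval : ∀ y : L, y ≠ 0 → v (a i * y ^ q ^ i) = v (a j * y ^ q ^ j) → v y = v y₀ := by
    intro y hy h1
    have hpow : ∀ z : L, z ≠ 0 → v (a i * z ^ q ^ i) = v (a j * z ^ q ^ j) →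
        v z ^ (q ^ j - q ^ i) = v (a i) / v (a j) := by
      intro z hz h2
      have hvz := v.ne_zero_iff.mpr hz
      have hvj := v.ne_zero_iff.mpr (ha j hj)
      have hle : q ^ i ≤ q ^ j := Nat.pow_le_pow_right hq1.le hij.le
      rw [map_mul, map_mul, map_pow, map_pow] at h2
      rw [eq_div_iff hvj]
      apply mul_right_cancel₀ (pow_ne_zero (q ^ i) hvz)
      rw [h2, mul_right_comm, ← pow_add, Nat.sub_add_cancel hle, mul_comm]
    have hpos : q ^ j - q ^ i ≠ 0 := by
      have := Nat.pow_lt_pow_right hq1 hij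
      omega
    exact (pow_left_inj₀ zero_le zero_le hpos).mp ((hpow y hy h1).trans (hpow y₀ hy₀ heq).symm)
  have hUW : U ≤ W := hUB.trans hBW
  have : FiniteDimensional Fq B := Submodule.finiteDimensional_of_le hBW
  have : FiniteDimensional Fq U := Submodule.finiteDimensional_of_le hUW
  have : FiniteDimensional Fq (C ⊓ W : Submodule Fq L) :=
    Submodule.finiteDimensional_of_le inf_le_right
  have hsup : B ⊔ C ⊓ W = W := by
    rw [← sup_inf_assoc_of_le _ hBW, hC.sup_eq_top, top_inf_eq]
  have hdisj : B ⊓ (C ⊓ W) = ⊥ := by rw [← inf_assoc, hC.inf_eq_bot, bot_inf_eq]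
  have hmod : (U ⊔ C ⊓ W) ⊓ B = U := by
    rw [sup_inf_assoc_of_le _ hUB, inf_comm (C ⊓ W) B, hdisj, sup_bot_eq]
  refine ⟨U ⊔ C ⊓ W, sup_le hUW inf_le_right, ?_, ?_⟩
  · have h1 := Submodule.finrank_sup_add_finrank_inf_eq B (C ⊓ W)
    have h2 := Submodule.finrank_sup_add_finrank_inf_eq U (C ⊓ W)
    have h3 : U ⊓ (C ⊓ W) = ⊥ := le_bot_iff.mp (hdisj ▸ inf_le_inf_right _ hUB)
    rw [hsup, hdisj, finrank_bot] at h1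
    rw [h3, finrank_bot] at h2
    omega
  · intro y hy hy0 h1 h2
    by_contra hbad
    have hvy := hval y hy0 h1
    have hyB : y ∈ B := by
      refine ⟨⟨?_, hvy.le⟩, Submodule.mem_top, ?_⟩
      · exact (sup_le hUW inf_le_right : U ⊔ C ⊓ W ≤ W) hy
      · simp only [IsDominated, not_forall, not_le] at hbad
        obtain ⟨k, hk, hlt⟩ := hbad
        refine hlt.trans_le ((h2 k hk).trans (le_of_eq ?_))
        rw [map_mul, map_mul, map_pow, map_pow, hvy]
    have hyU : y ∈ U := hmod ▸ (⟨hy, hyB⟩ : y ∈ (U ⊔ C ⊓ W) ⊓ B)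
    exact hyU.2.ne hvy

/-- On a subspace of bounded codimension there is no cancellation in `f`. -/
theorem exists_subspace_isDominated (v : Valuation L Γ) (S : Finset ℕ) (a : ℕ → L)
    (ha : ∀ i ∈ S, a i ≠ 0) (f : L →ₗ[Fq] L)
    (hf : ∀ y, f y = ∑ i ∈ S, a i * y ^ Nat.card Fq ^ i)
    (W : Submodule Fq L) [FiniteDimensional Fq W] :
    ∃ W' ≤ W, Module.finrank Fq W ≤ Module.finrank Fq W' + (S ×ˢ S).card * S.sup id ∧
      ∀ y ∈ W', IsDominated v S a (Nat.card Fq) f y := by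
  classical
  set q := Nat.card Fq with hq
  -- The pairs are treated one at a time, each costing at most `S.sup id` dimensions.
  have key : ∀ T ⊆ S ×ˢ S, ∃ W' ≤ W,
      Module.finrank Fq W ≤ Module.finrank Fq W' + T.card * S.sup id ∧
      ∀ p ∈ T, p.1 < p.2 → ∀ y ∈ W', y ≠ 0 →
        v (a p.1 * y ^ q ^ p.1) = v (a p.2 * y ^ q ^ p.2) →
        (∀ k ∈ S, v (a k * y ^ q ^ k) ≤ v (a p.1 * y ^ q ^ p.1)) →
        IsDominated v S a q f y := by
    intro T
    induction T using Finset.induction_on with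
    | empty => exact fun _ => ⟨W, le_rfl, by simp, by simp⟩
    | insert p T hp ih =>
      intro hT
      obtain ⟨W₁, hW₁, hd₁, h₁⟩ := ih fun x hx => hT (Finset.mem_insert_of_mem hx)
      have hpS := Finset.mem_product.mp (hT (Finset.mem_insert_self p T))
      have : FiniteDimensional Fq W₁ := Submodule.finiteDimensional_of_le hW₁
      rw [Finset.card_insert_of_notMem hp, add_mul, one_mul]
      by_cases hlt : p.1 < p.2
      · obtain ⟨W₂, hW₂, hd₂, h₂⟩ :=
          exists_subspace_no_pair_cancellation v S a ha f hf hpS.1 hpS.2 hlt W₁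
        refine ⟨W₂, hW₂.trans hW₁, by omega, fun p' hp' hlt' y hy => ?_⟩
        rcases Finset.mem_insert.mp hp' with rfl | hp'
        · exact h₂ y hy
        · exact h₁ p' hp' hlt' y (hW₂ hy)
      · refine ⟨W₁, hW₁, by omega, fun p' hp' hlt' y hy => ?_⟩
        rcases Finset.mem_insert.mp hp' with rfl | hp'
        · exact (hlt hlt').elim
        · exact h₁ p' hp' hlt' y hy
  obtain ⟨W', hW', hd, h⟩ := key _ subset_rfl
  refine ⟨W', hW', hd, fun y hy => ?_⟩
  by_cases hy0 : y = 0
  · intro i _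
    have : q ^ i ≠ 0 := pow_ne_zero _ Nat.card_pos.ne'
    rw [hy0, zero_pow this, mul_zero, map_zero]
    exact zero_le
  rcases S.eq_empty_or_nonempty with rfl | hS
  · intro i hi; simp at hi
  obtain ⟨i, hi, hmax⟩ := S.exists_max_image (fun i => v (a i * y ^ q ^ i)) hS
  -- A strictly largest monomial determines `v (f y)`. Cancellation thus needs two largest
  -- monomials, which is the case covered by `h`.
  by_cases hu : ∃ j ∈ S, j ≠ i ∧ v (a j * y ^ q ^ j) = v (a i * y ^ q ^ i)
  · obtain ⟨j, hj, hji, hv⟩ := hu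
    rcases lt_or_gt_of_ne hji with hlt | hlt
    · exact h (j, i) (Finset.mk_mem_product hj hi) hlt y hy hy0 hv fun k hk => (hmax k hk).trans hv.ge
    · exact h (i, j) (Finset.mk_mem_product hi hj) hlt y hy hy0 hv.symm hmax
  · intro k hk
    rw [hf, v.map_sum_eq_of_lt hi fun j hj => ?_]
    · exact hmax k hk
    · rw [Finset.mem_sdiff, Finset.mem_singleton] at hj
      exact lt_of_le_of_ne (hmax j hj.1) fun he => hu ⟨j, hj.1, hj.2, he⟩

/-- A subspace of large dimension contains an element without cancellations in the first `n`
steps of its orbit under `f`, if `f` is injective on the subspace and its images. -/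
theorem exists_isDominated_iterate (v : Valuation L Γ) (S : Finset ℕ) (a : ℕ → L)
    (ha : ∀ i ∈ S, a i ≠ 0) (f : L →ₗ[Fq] L)
    (hf : ∀ y, f y = ∑ i ∈ S, a i * y ^ Nat.card Fq ^ i) (p : L → Prop) (hp0 : ¬ p 0)
    (hp : ∀ y, p y → p (f y)) (n : ℕ) (W : Submodule Fq L) [FiniteDimensional Fq W]
    (hW : ∀ y ∈ W, y ≠ 0 → p y)
    (hdim : n * ((S ×ˢ S).card * S.sup id) < Module.finrank Fq W) :
    ∃ z ∈ W, z ≠ 0 ∧ ∀ k < n, IsDominated v S a (Nat.card Fq) f (f^[k] z) := by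
  induction n generalizing W with
  | zero =>
    have : W ≠ ⊥ := fun h => by
      rw [h, finrank_bot] at hdim
      omega
    obtain ⟨z, hz, hz0⟩ := W.exists_mem_ne_zero_of_ne_bot this
    exact ⟨z, hz, hz0, by simp⟩
  | succ n ih =>
    obtain ⟨W', hW', hd, hdom⟩ := exists_subspace_isDominated v S a ha f hf W
    have : FiniteDimensional Fq W' := Submodule.finiteDimensional_of_le hW'
    -- The predicate `p`, later positivity of the height, survives `f` and fails at `0`. It keeps
    -- `f` injective, so no dimension is lost in passing from `W'` to its image.
    have hinj : Function.Injective (f.domRestrict W') := by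
      rw [← LinearMap.ker_eq_bot, LinearMap.ker_eq_bot']
      intro y hy
      by_contra hy0
      have hpy := hp y (hW y (hW' y.2) fun h => hy0 (Subtype.ext h))
      rw [show f y = 0 from hy] at hpy
      exact hp0 hpy
    have hfin : Module.finrank Fq (W'.map f) = Module.finrank Fq W' := by
      rw [← LinearMap.range_domRestrict]
      exact LinearMap.finrank_range_of_inj hinj
    obtain ⟨_, ⟨z, hz, rfl⟩, hz0, hzdom⟩ := ih (W'.map f) (by
      rintro _ ⟨y, hy, rfl⟩ hy0
      exact hp y (hW y (hW' hy) fun h => hy0 (by rw [h, map_zero]))) (by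
      rw [hfin]; rw [add_mul, one_mul] at hdim; omega)
    refine ⟨z, hW' hz, fun h => hz0 (by rw [h, map_zero]), fun k hk => ?_⟩
    cases k with
    | zero => exact hdom z hz
    | succ k => exact hzdom k (by omega)

end Domination

/-! ### Tate's construction of canonical heights -/

section CanonicalHeight

/-- The source of the exact relations below: a defect that is multiplied by `D` under the map, yet
stays bounded, cannot be positive. -/
theorem nonpos_of_pow_mul_le {D t B : ℝ} (hD : 1 < D) (h : ∀ n : ℕ, D ^ n * t ≤ B) : t ≤ 0 := by
  by_contra! ht
  obtain ⟨n, hn⟩ := pow_unbounded_of_one_lt (B / t) hD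
  rw [div_lt_iff₀ ht] at hn
  exact absurd (h n) (not_le.mpr hn)

/-- `h` is a canonical height for the map `f` of degree `D` and the function `ℓ`. -/
structure IsCanonicalHeight {X : Type*} (f : X → X) (D : ℝ) (ℓ : X → ℝ) (c : ℝ) (h : X → ℝ) :
    Prop where
  one_lt : 1 < D
  map : ∀ y, h (f y) = D * h y
  sub_le : ∀ y, |h y - ℓ y| ≤ c

/-- The height is the limit of `ℓ (f^[n] y) / D ^ n`. Successive terms differ by at most `c / D ^ (n
+ 1)`, and `2 ≤ D` allows comparison with the geometric series of ratio `1/2`. -/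
theorem exists_isCanonicalHeight {X : Type*} (f : X → X) {D : ℝ} (hD : 2 ≤ D) (ℓ : X → ℝ) {c : ℝ}
    (hc : ∀ y, |ℓ (f y) - D * ℓ y| ≤ c) : ∃ h, IsCanonicalHeight f D ℓ c h := by
  have hD0 : 0 < D := by linarith
  have hstep : ∀ y (n : ℕ), dist (ℓ (f^[n] y) / D ^ n) (ℓ (f^[n + 1] y) / D ^ (n + 1)) ≤
      c / 2 / 2 ^ n := by
    intro y n
    have h1 := hc (f^[n] y)
    have hc0 : 0 ≤ c := (abs_nonneg _).trans h1
    rw [Function.iterate_succ_apply', dist_comm, Real.dist_eq]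
    have : ℓ (f (f^[n] y)) / D ^ (n + 1) - ℓ (f^[n] y) / D ^ n =
        (ℓ (f (f^[n] y)) - D * ℓ (f^[n] y)) / D ^ (n + 1) := by
      field_simp
      ring
    rw [this, abs_div, abs_of_pos (pow_pos hD0 _), div_div, ← pow_succ']
    exact div_le_div₀ hc0 h1 (by positivity) (pow_le_pow_left₀ (by norm_num) hD _)
  have hlim : ∀ y, ∃ l, Tendsto (fun n => ℓ (f^[n] y) / D ^ n) atTop (𝓝 l) := fun y =>
    cauchySeq_tendsto_of_complete (cauchySeq_of_le_geometric_two (hstep y))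
  choose h hh using hlim
  refine ⟨h, by linarith, fun y => ?_, fun y => ?_⟩
  · refine tendsto_nhds_unique (hh (f y)) ?_
    refine (((hh y).comp (tendsto_add_atTop_nat 1)).const_mul D).congr fun n => ?_
    simp only [Function.comp, Function.iterate_succ_apply]
    field_simp
    ring
  · have := dist_le_of_le_geometric_two_of_tendsto₀ (hstep y) (hh y)
    simpa [Real.dist_eq, abs_sub_comm] using this

namespace IsCanonicalHeight

variable {X : Type*} {f : X → X} {D : ℝ} {ℓ : X → ℝ} {c : ℝ} {h : X → ℝ}

theorem map_iterate (H : IsCanonicalHeight f D ℓ c h) (n : ℕ) (y : X) :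
    h (f^[n] y) = D ^ n * h y := by
  induction n with
  | zero => simp
  | succ n ih => rw [Function.iterate_succ_apply', H.map, ih, pow_succ']; ring

theorem nonpos_of_bounded (H : IsCanonicalHeight f D ℓ c h) {y : X} {B : ℝ}
    (hB : ∀ n, ℓ (f^[n] y) ≤ B) : h y ≤ 0 :=
  nonpos_of_pow_mul_le H.one_lt (B := c + B) fun n => by
    have h1 := H.sub_le (f^[n] y)
    rw [H.map_iterate] at h1
    linarith [(abs_le.mp h1).2, hB n]

theorem add_le [Add X] (H : IsCanonicalHeight f D ℓ c h) (hf : ∀ y z, f (y + z) = f y + f z)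
    (hℓ : ∀ y z, ℓ (y + z) ≤ max (ℓ y) (ℓ z)) (y z : X) : h (y + z) ≤ max (h y) (h z) := by
  have : h (y + z) - max (h y) (h z) ≤ 0 :=
    nonpos_of_pow_mul_le H.one_lt (B := 2 * c) fun n => by
      have hD : 0 ≤ D ^ n := pow_nonneg (by linarith [H.one_lt]) n
      have hadd : ∀ n, f^[n] (y + z) = f^[n] y + f^[n] z := by
        intro n
        induction n with
        | zero => rfl
        | succ n ih => simp only [Function.iterate_succ_apply', ih, hf]
      rw [mul_sub, mul_max_of_nonneg _ _ hD, ← H.map_iterate, ← H.map_iterate, ← H.map_iterate,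
        hadd]
      have h1 := (abs_le.mp (H.sub_le (f^[n] y + f^[n] z))).2
      have h2 := (abs_le.mp (H.sub_le (f^[n] y))).1
      have h3 := (abs_le.mp (H.sub_le (f^[n] z))).1
      rcases le_max_iff.mp (hℓ (f^[n] y) (f^[n] z)) with h4 | h4
      · linarith [le_max_left (h (f^[n] y)) (h (f^[n] z))]
      · linarith [le_max_right (h (f^[n] y)) (h (f^[n] z))]
  linarith

/-- The canonical height is homogeneous for every map that commutes with `f`. -/
theorem map_of_commute (H : IsCanonicalHeight f D ℓ c h) {g : X → X} {d c' : ℝ}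
    (hg : ∀ y, |ℓ (g y) - d * ℓ y| ≤ c') (hfg : ∀ y, g (f y) = f (g y)) (y : X) :
    h (g y) = d * h y := by
  have hcomm : ∀ n, g (f^[n] y) = f^[n] (g y) := by
    intro n
    induction n with
    | zero => rfl
    | succ n ih => simp only [Function.iterate_succ_apply', hfg, ih]
  have key : ∀ n : ℕ, |D ^ n * (h (g y) - d * h y)| ≤ c + c' + |d| * c := by
    intro n
    have e : D ^ n * (h (g y) - d * h y) =
        (h (f^[n] (g y)) - ℓ (f^[n] (g y))) + (ℓ (g (f^[n] y)) - d * ℓ (f^[n] y)) -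
          d * (h (f^[n] y) - ℓ (f^[n] y)) := by
      rw [H.map_iterate, H.map_iterate, hcomm]; ring
    rw [e]
    refine (abs_sub _ _).trans (add_le_add ((abs_add_le _ _).trans
      (add_le_add (H.sub_le _) (hg _))) ?_)
    rw [abs_mul]
    exact mul_le_mul_of_nonneg_left (H.sub_le _) (abs_nonneg d)
  have : |h (g y) - d * h y| ≤ 0 := nonpos_of_pow_mul_le H.one_lt fun n => by
    have := key n
    rwa [abs_mul, abs_of_nonneg (pow_nonneg (by linarith [H.one_lt]) n)] at this
  linarith [abs_nonpos_iff.mp this]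

/-- By homogeneity `h` is also a canonical height for `g`, hence equals the limit formed with `g`.
This makes the local height independent of `a`. -/
theorem tendsto_of_commute (H : IsCanonicalHeight f D ℓ c h) {g : X → X} {d c' : ℝ} (hd : 1 < d)
    (hg : ∀ y, |ℓ (g y) - d * ℓ y| ≤ c') (hfg : ∀ y, g (f y) = f (g y)) (y : X) :
    Tendsto (fun n => ℓ (g^[n] y) / d ^ n) atTop (𝓝 (h y)) := by
  have Hg : IsCanonicalHeight g d ℓ c h := ⟨hd, H.map_of_commute hg hfg, H.sub_le⟩
  have h0 : Tendsto (fun n : ℕ => c / d ^ n) atTop (𝓝 0) :=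
    tendsto_const_nhds.div_atTop (tendsto_pow_atTop_atTop_of_one_lt hd)
  refine tendsto_iff_dist_tendsto_zero.mpr (squeeze_zero (fun _ => dist_nonneg) (fun n => ?_) h0)
  have hdn : 0 < d ^ n := pow_pos (by linarith) n
  have h1 := Hg.sub_le (g^[n] y)
  rw [Hg.map_iterate, abs_sub_comm] at h1
  rw [Real.dist_eq, le_div_iff₀ hdn]
  calc _ = |ℓ (g^[n] y) / d ^ n - h y| * |d ^ n| := by rw [abs_of_pos hdn]
    _ = |ℓ (g^[n] y) - d ^ n * h y| := by rw [← abs_mul]; congr 1; field_simp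
    _ ≤ c := h1

end IsCanonicalHeight

end CanonicalHeight

/-! ### Growth of polynomial maps for a discrete valuation -/

section LogPlus

open WithZero

variable {L : Type*} [Field L]

/-- `max {0, -w(y)}` for the additive valuation `w` belonging to `v`. -/
def logPlus (v : Valuation L (WithZero (Multiplicative ℤ))) (y : L) : ℤ := max 0 (log (v y))

variable (v : Valuation L (WithZero (Multiplicative ℤ)))

theorem logPlus_nonneg (y : L) : 0 ≤ logPlus v y := le_max_left _ _

theorem log_le_logPlus (y : L) : log (v y) ≤ logPlus v y := le_max_right _ _

theorem le_exp_logPlus (y : L) : v y ≤ exp (logPlus v y) :=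
  le_exp_of_log_le (log_le_logPlus v y)

theorem logPlus_le_iff {y : L} {n : ℤ} (hn : 0 ≤ n) : logPlus v y ≤ n ↔ v y ≤ exp n := by
  refine ⟨fun h => (le_exp_logPlus v y).trans (exp_le_exp.mpr h), fun h => max_le hn ?_⟩
  by_cases hy : v y = 0
  · simpa [hy] using hn
  · exact (log_le_iff_le_exp hy).mpr h

theorem logPlus_add_le (y z : L) : logPlus v (y + z) ≤ max (logPlus v y) (logPlus v z) := by
  rw [logPlus_le_iff v ((logPlus_nonneg v y).trans (le_max_left _ _))]
  exact v.map_add_le ((le_exp_logPlus v y).trans (exp_le_exp.mpr (le_max_left _ _)))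
    ((le_exp_logPlus v z).trans (exp_le_exp.mpr (le_max_right _ _)))

open Polynomial in
theorem logPlus_eval_le (P : L[X]) {E : ℤ} (hE0 : 0 ≤ E)
    (hE : ∀ i ∈ P.support, log (v (P.coeff i)) ≤ E) (y : L) :
    logPlus v (P.eval y) ≤ P.natDegree * logPlus v y + E := by
  have hl := logPlus_nonneg v y
  rw [logPlus_le_iff v (by positivity), eval_eq_sum, sum_def]
  refine v.map_sum_le fun i hi => ?_
  rw [map_mul, map_pow]
  calc v (P.coeff i) * v y ^ i ≤ exp E * exp (logPlus v y) ^ i :=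
        mul_le_mul' (le_exp_of_log_le (hE i hi)) (pow_le_pow_left' (le_exp_logPlus v y) i)
    _ = exp (E + i * logPlus v y) := by rw [← exp_nsmul, ← exp_add, nsmul_eq_mul]
    _ ≤ exp (P.natDegree * logPlus v y + E) := by
        rw [exp_le_exp, add_comm]
        have : (i : ℤ) ≤ P.natDegree := by exact_mod_cast le_natDegree_of_mem_supp i hi
        nlinarith

open Polynomial in
theorem le_logPlus_eval (P : L[X]) (hP : P ≠ 0) {E : ℤ} (hE0 : 0 ≤ E)
    (hE : ∀ i ∈ P.support, |log (v (P.coeff i))| ≤ E) (y : L) :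
    P.natDegree * logPlus v y ≤ logPlus v (P.eval y) + E * (2 * P.natDegree + 1) := by
  have hl := logPlus_nonneg v y
  have hl' := logPlus_nonneg v (P.eval y)
  -- For small `y` the error term alone suffices. Above `2 * E` the leading monomial is strictly the
  -- largest.
  by_cases hy : logPlus v y ≤ 2 * E
  · have : (0 : ℤ) ≤ P.natDegree := by positivity
    nlinarith
  push Not at hy
  set d := P.natDegree with hd
  have hlog : log (v y) = logPlus v y := by
    have : logPlus v y = max 0 (log (v y)) := rfl
    omega
  have hvy : v y ≠ 0 := fun h => by rw [h, log_zero] at hlog; omega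
  have hvy' : v y = exp (logPlus v y) := by rw [← hlog, exp_log hvy]
  have hterm : ∀ i ∈ P.support, v (P.coeff i * y ^ i) =
      exp (log (v (P.coeff i)) + i * logPlus v y) := fun i hi => by
    rw [map_mul, map_pow, hvy', ← exp_nsmul, nsmul_eq_mul, exp_add,
      exp_log (v.ne_zero_iff.mpr (mem_support_iff.mp hi))]
  have hdmem : d ∈ P.support := natDegree_mem_support_of_nonzero hP
  have hsum : v (P.eval y) = v (P.coeff d * y ^ d) := by
    rw [eval_eq_sum, sum_def]
    refine v.map_sum_eq_of_lt hdmem fun i hi => ?_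
    rw [Finset.mem_sdiff, Finset.mem_singleton] at hi
    rw [hterm i hi.1, hterm d hdmem, exp_lt_exp]
    have h1 := (abs_le.mp (hE i hi.1)).2
    have h2 := (abs_le.mp (hE d hdmem)).1
    have h3 : (i : ℤ) + 1 ≤ d := by
      have := le_natDegree_of_mem_supp i hi.1
      have := hi.2
      omega
    nlinarith
  have h4 := log_le_logPlus v (P.eval y)
  rw [hsum, hterm d hdmem, log_exp] at h4
  have h2 := (abs_le.mp (hE d hdmem)).1
  have : (0 : ℤ) ≤ d := by positivity
  nlinarith

open Polynomial in
/-- The function `logPlus` is quasi-homogeneous for a polynomial map. -/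
theorem abs_logPlus_eval_sub_le (P : L[X]) (hP : P ≠ 0) {E : ℤ} (hE0 : 0 ≤ E)
    (hE : ∀ i ∈ P.support, |log (v (P.coeff i))| ≤ E) (y : L) :
    |(logPlus v (P.eval y) : ℝ) - P.natDegree * logPlus v y| ≤ E * (2 * P.natDegree + 1) := by
  have h1 := logPlus_eval_le v P hE0 (fun i hi => (le_abs_self _).trans (hE i hi)) y
  have h2 := le_logPlus_eval v P hP hE0 hE y
  have h3 : |logPlus v (P.eval y) - P.natDegree * logPlus v y| ≤ E * (2 * P.natDegree + 1) := by
    rw [abs_le]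
    constructor
    · linarith
    · have : (0 : ℤ) ≤ P.natDegree := by positivity
      nlinarith
  exact_mod_cast h3

end LogPlus

/-! ### Lower bound for a positive canonical height -/

section LowerBound

open WithZero

variable {Fq : Type*} [Field Fq] {L : Type*} [Field L] [Algebra Fq L]

variable {v : Valuation L (WithZero (Multiplicative ℤ))} {S : Finset ℕ} {a : ℕ → L}
  {f : L →ₗ[Fq] L} {D c : ℝ} {h : L → ℝ}

theorem IsCanonicalHeight.map_zero
    (H : IsCanonicalHeight f D (fun y => (logPlus v y : ℝ)) c h) : h 0 = 0 := by
  have h1 := H.map 0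
  rw [_root_.map_zero] at h1
  have h2 := H.one_lt
  nlinarith

theorem IsCanonicalHeight.add_le_max
    (H : IsCanonicalHeight f D (fun y => (logPlus v y : ℝ)) c h) (y z : L) :
    h (y + z) ≤ max (h y) (h z) :=
  H.add_le (_root_.map_add f) (fun y z => by exact_mod_cast logPlus_add_le v y z) y z

/-- If a ball is stable under `f`, then its elements have height zero. -/
theorem IsCanonicalHeight.nonpos_of_ball_stable
    (H : IsCanonicalHeight f D (fun y => (logPlus v y : ℝ)) c h)
    (hf : ∀ y, f y = ∑ i ∈ S, a i * y ^ Nat.card Fq ^ i) {s : WithZero (Multiplicative ℤ)}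
    (hs : ∀ i ∈ S, v (a i) * s ^ Nat.card Fq ^ i ≤ s) {y : L} (hy : v y ≤ s) : h y ≤ 0 := by
  have hball : ∀ n, v (f^[n] y) ≤ s := by
    intro n
    induction n with
    | zero => exact hy
    | succ n ih =>
      rw [Function.iterate_succ_apply', hf]
      refine v.map_sum_le fun i hi => ?_
      rw [map_mul, map_pow]
      exact (mul_le_mul' le_rfl (pow_le_pow_left' ih _)).trans (hs i hi)
  refine H.nonpos_of_bounded (B := ((max 0 (log s) : ℤ) : ℝ)) fun n => ?_
  have : logPlus v (f^[n] y) ≤ max 0 (log s) :=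
    (logPlus_le_iff v (le_max_left _ _)).mpr
      ((hball n).trans (le_exp_log.trans (exp_le_exp.mpr (le_max_right _ _))))
  exact_mod_cast this

/-- If `v (f y) ≤ v y`, domination bounds every monomial at `y` by `v y`. The ball of radius `v y`
is then stable under `f`, and the height of `y` cannot be positive. -/
theorem IsCanonicalHeight.log_lt_log_of_isDominated (hf : ∀ y, f y = ∑ i ∈ S, a i * y ^ Nat.card Fq ^ i)
    (H : IsCanonicalHeight f D (fun y => (logPlus v y : ℝ)) c h) {y : L} (hy : 0 < h y)
    (hdom : IsDominated v S a (Nat.card Fq) f y) : log (v y) < log (v (f y)) := by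
  have hne : ∀ z, 0 < h z → v z ≠ 0 := fun z hz h0 => by
    rw [v.zero_iff] at h0
    rw [h0, H.map_zero] at hz
    exact hz.false
  have hfy : 0 < h (f y) := by
    rw [H.map]; exact mul_pos (by linarith [H.one_lt]) hy
  rw [log_lt_log (hne y hy) (hne _ hfy)]
  by_contra! hle
  refine absurd (H.nonpos_of_ball_stable hf (s := v y) (fun i hi => ?_) le_rfl) (not_le.mpr hy)
  have := (hdom i hi).trans hle
  rwa [map_mul, map_pow] at this

/-- Without cancellations the orbit expands by the factor `q` in each step. -/
theorem IsCanonicalHeight.mul_log_sub_le (h0S : 0 ∉ S)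
    (hf : ∀ y, f y = ∑ i ∈ S, a i * y ^ Nat.card Fq ^ i)
    (H : IsCanonicalHeight f D (fun y => (logPlus v y : ℝ)) c h) {y : L} (hy : 0 < h y)
    (hdom : IsDominated v S a (Nat.card Fq) f y)
    (hdom' : IsDominated v S a (Nat.card Fq) f (f y)) :
    Nat.card Fq * (log (v (f y)) - log (v y)) ≤ log (v (f (f y))) - log (v (f y)) := by
  set q := Nat.card Fq with hq
  have hne : ∀ z, 0 < h z → v z ≠ 0 := fun z hz h0 => by
    rw [v.zero_iff] at h0
    rw [h0, H.map_zero] at hz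
    exact hz.false
  have hD : 0 < D := by linarith [H.one_lt]
  have hfy : 0 < h (f y) := by rw [H.map]; positivity
  have hffy : 0 < h (f (f y)) := by rw [H.map]; positivity
  have hlt := H.log_lt_log_of_isDominated hf hy hdom
  -- The monomial that bounds `f y` from above at `y` also bounds `f (f y)` from below at `f y`.
  -- Subtraction removes its coefficient and leaves the factor `q ^ i`, at least `q` because `i ≠
  -- 0`.
  obtain ⟨i, hi, hle⟩ : ∃ i ∈ S, v (f y) ≤ v (a i * y ^ q ^ i) := by
    by_contra! hcon
    have := v.map_sum_lt (hne _ hfy) hcon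
    rw [← hf] at this
    exact this.false
  have hai : v (a i) ≠ 0 := fun h0 => by
    rw [map_mul, h0, zero_mul] at hle
    exact hne _ hfy (le_zero_iff.mp hle)
  have h1 : log (v (f y)) ≤ log (v (a i)) + (q ^ i : ℕ) * log (v y) := by
    have := (log_le_log (hne _ hfy) (ne_of_gt ((zero_lt_iff.mpr (hne _ hfy)).trans_le hle))).mpr hle
    rwa [map_mul, map_pow, log_mul hai (pow_ne_zero _ (hne y hy)), log_pow, nsmul_eq_mul] at this
  have h2 : log (v (a i)) + (q ^ i : ℕ) * log (v (f y)) ≤ log (v (f (f y))) := by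
    have h3 := hdom' i hi
    rw [map_mul, map_pow] at h3
    have := (log_le_log (mul_ne_zero hai (pow_ne_zero _ (hne _ hfy))) (hne _ hffy)).mpr h3
    rwa [log_mul hai (pow_ne_zero _ (hne _ hfy)), log_pow, nsmul_eq_mul] at this
  have hi0 : i ≠ 0 := fun h => h0S (h ▸ hi)
  have h4 : (q : ℤ) ≤ (q ^ i : ℕ) := by exact_mod_cast Nat.le_self_pow hi0 q
  nlinarith

variable [Finite Fq]

theorem logPlus_smul (v : Valuation L (WithZero (Multiplicative ℤ))) {b : Fq} (hb : b ≠ 0) (y : L) :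
    logPlus v (b • y) = logPlus v y := by
  rw [logPlus, logPlus, Algebra.smul_def, map_mul, valuation_algebraMap_eq_one v hb, one_mul]

theorem IsCanonicalHeight.map_smul
    (H : IsCanonicalHeight f D (fun y => (logPlus v y : ℝ)) c h) {b : Fq} (hb : b ≠ 0) (y : L) :
    h (b • y) = h y := by
  simpa using H.map_of_commute (g := fun y => b • y) (d := 1) (c' := 0)
    (fun y => by simp [logPlus_smul v hb]) (fun y => (_root_.map_smul f b y).symm) y

/-- The height of a combination of elements of an orbit of positive height. -/
theorem IsCanonicalHeight.sum_iterate
    (H : IsCanonicalHeight f D (fun y => (logPlus v y : ℝ)) c h) {x : L} (hx : 0 < h x)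
    (b : ℕ → Fq) (m : ℕ) :
    h (∑ j ∈ Finset.range m, b j • f^[j] x) < D ^ m * h x ∧
      (h (∑ j ∈ Finset.range m, b j • f^[j] x) ≤ 0 → ∀ j < m, b j = 0) := by
  have hD := H.one_lt
  induction m with
  | zero => simpa [H.map_zero] using hx
  | succ m ih =>
    rw [Finset.sum_range_succ]
    set s := ∑ j ∈ Finset.range m, b j • f^[j] x
    have hlt : D ^ m * h x < D ^ (m + 1) * h x := by
      rw [pow_succ]
      have : 0 < D ^ m * h x := by positivity
      nlinarith
    by_cases hb : b m = 0
    · rw [hb, zero_smul, add_zero]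
      refine ⟨ih.1.trans hlt, fun h0 j hj => ?_⟩
      rcases Nat.lt_succ_iff_lt_or_eq.mp hj with hj | rfl
      · exact ih.2 h0 j hj
      · exact hb
    -- The earlier terms have a sum of height below `D ^ m * h x`. Since the last term is the whole
    -- sum minus these, a whole sum of height at most zero would contradict the ultrametric
    -- inequality.
    · have htop : h (b m • f^[m] x) = D ^ m * h x := by rw [H.map_smul hb, H.map_iterate]
      constructor
      · exact (H.add_le_max _ _).trans_lt (max_lt (ih.1.trans hlt) (htop ▸ hlt))
      · intro h0
        exfalso
        have h1 := H.add_le_max (s + b m • f^[m] x) (-s)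
        have h2 : h (-s) = h s := by
          have := H.map_smul (b := (-1 : Fq)) (by simp) s
          rwa [neg_smul, one_smul] at this
        rw [add_neg_cancel_comm, htop, h2] at h1
        have h3 : 0 < D ^ m * h x := by positivity
        rcases le_max_iff.mp h1 with h4 | h4
        · linarith
        · linarith [ih.1]

/-- All exponents `q ^ i` with `i ≠ 0` are at least `2`, so the ball of radius `exp (-E)` is stable
under `f` and contains no element of positive height. -/
theorem IsCanonicalHeight.neg_lt_log (h0S : 0 ∉ S)
    (hf : ∀ y, f y = ∑ i ∈ S, a i * y ^ Nat.card Fq ^ i)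
    (H : IsCanonicalHeight f D (fun y => (logPlus v y : ℝ)) c h) {E : ℤ} (hE0 : 0 ≤ E)
    (hE : ∀ i ∈ S, log (v (a i)) ≤ E) {y : L} (hy : 0 < h y) : -E < log (v y) := by
  have hvy : v y ≠ 0 := fun h0 => by
    rw [v.zero_iff] at h0
    rw [h0, H.map_zero] at hy
    exact hy.false
  by_contra! hle
  refine absurd (H.nonpos_of_ball_stable hf (s := exp (-E)) (fun i hi => ?_)
    (le_exp_of_log_le hle)) (not_le.mpr hy)
  have hi0 : i ≠ 0 := fun h => h0S (h ▸ hi)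
  have hq : 2 ≤ Nat.card Fq ^ i :=
    (Finite.one_lt_card (α := Fq)).trans_le (Nat.le_self_pow hi0 _)
  calc v (a i) * exp (-E) ^ Nat.card Fq ^ i ≤ exp E * exp (-E) ^ Nat.card Fq ^ i :=
        mul_le_mul' (le_exp_of_log_le (hE i hi)) le_rfl
    _ = exp (E + (Nat.card Fq ^ i : ℕ) * (-E)) := by rw [← exp_nsmul, ← exp_add, nsmul_eq_mul]
    _ ≤ exp (-E) := by
      rw [exp_le_exp]
      have : (2 : ℤ) ≤ (Nat.card Fq ^ i : ℕ) := by exact_mod_cast hq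
      nlinarith

/-- The lower bound for the canonical height in terms of the number of steps that an orbit without
cancellations needs to leave the region where the height is not determined by the valuation. -/
theorem IsCanonicalHeight.one_le_pow_mul (h0S : 0 ∉ S)
    (hf : ∀ y, f y = ∑ i ∈ S, a i * y ^ Nat.card Fq ^ i)
    (ha : ∀ i ∈ S, a i ≠ 0)
    (H : IsCanonicalHeight f D (fun y => (logPlus v y : ℝ)) c h) {E : ℤ} (hE0 : 0 ≤ E)
    (hE : ∀ i ∈ S, log (v (a i)) ≤ E) {x : L} (hx : 0 < h x) {n : ℕ}
    (hn : c + 1 + E < (Nat.card Fq : ℝ) ^ n) :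
    1 ≤ D ^ ((n + 1) * ((S ×ˢ S).card * S.sup id) + n + 2) * h x := by
  set q := Nat.card Fq with hq
  set N := (n + 1) * ((S ×ˢ S).card * S.sup id) with hN
  have hD := H.one_lt
  have hD0 : 0 < D := by linarith
  -- The first `N + 1` orbit points of `x` are independent because nonzero combinations have
  -- positive height. Their span has one dimension more than `n + 1` steps without cancellation can
  -- cost.
  let g : (Fin (N + 1) → Fq) →ₗ[Fq] L := Fintype.linearCombination Fq fun j => f^[j] x
  have hg : ∀ b : Fin (N + 1) → Fq, ∃ b' : ℕ → Fq, (∀ j : Fin (N + 1), b' j = b j) ∧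
      g b = ∑ j ∈ Finset.range (N + 1), b' j • f^[j] x := by
    intro b
    refine ⟨fun j => if hj : j < N + 1 then b ⟨j, hj⟩ else 0, fun j => by beta_reduce; rw [dif_pos j.2], ?_⟩
    rw [Finset.sum_range, Fintype.linearCombination_apply]
    exact Finset.sum_congr rfl fun j _ => by beta_reduce; rw [dif_pos j.2]
  have hgpos : ∀ b, 0 < h (g b) ∨ b = 0 := by
    intro b
    obtain ⟨b', hb', hgb⟩ := hg b
    by_cases h0 : h (g b) ≤ 0
    · refine Or.inr (funext fun j => ?_)
      rw [← hb', (H.sum_iterate hx b' (N + 1)).2 (hgb ▸ h0) j j.2, Pi.zero_apply]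
    · exact Or.inl (not_le.mp h0)
  have hginj : Function.Injective g := by
    rw [← LinearMap.ker_eq_bot, LinearMap.ker_eq_bot']
    intro b hb
    refine (hgpos b).resolve_left fun h1 => ?_
    rw [hb, H.map_zero] at h1
    exact h1.false
  obtain ⟨z, ⟨b, rfl⟩, hz0, hdom⟩ := exists_isDominated_iterate v S a ha f hf (fun y => 0 < h y)
    (by simp [H.map_zero]) (fun y hy => by rw [H.map]; positivity) (n + 1) (LinearMap.range g)
    (by
      rintro _ ⟨b, rfl⟩ hb
      exact (hgpos b).resolve_right fun h => hb (by rw [h, _root_.map_zero]))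
    (by
      rw [LinearMap.finrank_range_of_inj hginj, Module.finrank_fin_fun]
      exact Nat.lt_succ_self _)
  set z := g b with hz
  have hzpos : 0 < h z := (hgpos b).resolve_right fun h => hz0 (by rw [hz, h, _root_.map_zero])
  have hzlt : h z < D ^ (N + 1) * h x := by
    obtain ⟨b', -, hgb⟩ := hg b
    rw [hz, hgb]
    exact (H.sum_iterate hx b' (N + 1)).1
  have hpos : ∀ k, 0 < h (f^[k] z) := fun k => by rw [H.map_iterate]; positivity
  -- The first gap is a positive integer, hence at least `1`; each further step multiplies it by at
  -- least `q`.
  have hgrow : ∀ k ≤ n, (q : ℤ) ^ k ≤ log (v (f^[k + 1] z)) - log (v (f^[k] z)) := by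
    intro k
    induction k with
    | zero =>
      intro _
      have := H.log_lt_log_of_isDominated hf (hpos 0) (hdom 0 (by omega))
      simp only [Function.iterate_zero, id] at this
      simp only [pow_zero, zero_add, Function.iterate_one, Function.iterate_zero, id]
      omega
    | succ k ih =>
      intro hk
      have h1 := H.mul_log_sub_le h0S hf (hpos k) (hdom k (by omega))
        (by simpa only [Function.iterate_succ_apply'] using hdom (k + 1) (by omega))
      simp only [Function.iterate_succ_apply'] at ih ⊢
      calc (q : ℤ) ^ (k + 1) = q * (q : ℤ) ^ k := pow_succ' _ _
        _ ≤ q * _ := mul_le_mul_of_nonneg_left (ih (by omega)) (by positivity)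
        _ ≤ _ := h1
  have h1 := hgrow n le_rfl
  have h2 := H.neg_lt_log h0S hf hE0 hE (hpos n)
  have h3 := log_le_logPlus v (f^[n + 1] z)
  have h4 : (q : ℤ) ^ n - E ≤ logPlus v (f^[n + 1] z) := by linarith
  have h5 : (q : ℝ) ^ n - E ≤ logPlus v (f^[n + 1] z) := by exact_mod_cast h4
  have h6 := (abs_le.mp (H.sub_le (f^[n + 1] z))).1
  have h7 : 1 ≤ h (f^[n + 1] z) := by linarith
  rw [H.map_iterate] at h7
  calc (1 : ℝ) ≤ D ^ (n + 1) * h z := h7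
    _ ≤ D ^ (n + 1) * (D ^ (N + 1) * h x) := mul_le_mul_of_nonneg_left hzlt.le (by positivity)
    _ = _ := by rw [← mul_assoc, ← pow_add]; congr 2; omega

/-- The lower bound for the canonical height, polynomial in the size `e` of the coefficients. -/
theorem IsCanonicalHeight.div_pow_le (h0S : 0 ∉ S)
    (hf : ∀ y, f y = ∑ i ∈ S, a i * y ^ Nat.card Fq ^ i)
    (ha : ∀ i ∈ S, a i ≠ 0)
    (hD : D = (Nat.card Fq : ℝ) ^ S.sup id) {E₀ e : ℕ} (he : 1 ≤ e)
    (H : IsCanonicalHeight f D (fun y => (logPlus v y : ℝ)) (E₀ * e * (2 * D + 1)) h)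
    (hE : ∀ i ∈ S, log (v (a i)) ≤ E₀ * e) {x : L} (hx : 0 < h x) :
    (((Nat.card Fq : ℝ) ^ 3 * (E₀ * (2 * D + 2) + 1)) ^
        (S.sup id * ((S ×ˢ S).card * S.sup id + 1)))⁻¹ /
      (e : ℝ) ^ (S.sup id * ((S ×ˢ S).card * S.sup id + 1)) ≤ h x := by
  set q := Nat.card Fq with hq
  set G := (S ×ˢ S).card * S.sup id with hG
  set T : ℝ := E₀ * (2 * D + 2) + 1 with hT
  have hq1 : (1 : ℝ) < q := by exact_mod_cast (Finite.one_lt_card (α := Fq))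
  have he' : (1 : ℝ) ≤ e := by exact_mod_cast he
  have hD1 := H.one_lt
  have hT1 : 1 ≤ T := by
    have : (0 : ℝ) ≤ E₀ * (2 * D + 2) := by positivity
    linarith
  have hTe : 1 ≤ T * e := by nlinarith
  -- `T * e` dominates `c + 1 + E`. With `n + 1` the least number of steps whose power of `q`
  -- exceeds it, `q ^ n ≤ T * e` turns a power of `D` with exponent linear in `n` into a power of
  -- `e`.
  obtain ⟨n, hn, hn'⟩ := exists_nat_pow_near hTe hq1
  have h1 := H.one_le_pow_mul h0S hf ha (E := E₀ * e) (by positivity) hE hx (n := n + 1) (by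
    refine lt_of_le_of_lt ?_ hn'
    push_cast
    nlinarith)
  have h2 : D ^ ((n + 1 + 1) * G + (n + 1) + 2) ≤
      ((q : ℝ) ^ 3 * T) ^ (S.sup id * (G + 1)) * (e : ℝ) ^ (S.sup id * (G + 1)) := by
    calc D ^ ((n + 1 + 1) * G + (n + 1) + 2) ≤ D ^ ((n + 3) * (G + 1)) :=
          pow_le_pow_right₀ hD1.le (by nlinarith)
      _ = ((q : ℝ) ^ n * (q : ℝ) ^ 3) ^ (S.sup id * (G + 1)) := by
          rw [hD, ← pow_add, ← pow_mul, ← pow_mul]; congr 1; ring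
      _ ≤ (T * e * (q : ℝ) ^ 3) ^ (S.sup id * (G + 1)) := by gcongr
      _ = _ := by rw [← mul_pow]; congr 1; ring
  have h3 := h1.trans (mul_le_mul_of_nonneg_right h2 hx.le)
  rw [inv_eq_one_div, div_div, div_le_iff₀ (by positivity), mul_comm (h x)]
  exact h3

end LowerBound

/-! ### Twisted polynomials as additive polynomials under composition -/

namespace TwistedPoly

open Polynomial

variable {Fq : Type*} [Field Fq] [Finite Fq] {K : Type*} [Field K] [Algebra Fq K]

/-- The additive polynomial `∑ aᵢ X ^ (q ^ i)` given by `∑ aᵢ τ ^ i`. -/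
noncomputable def toPoly (f : TwistedPoly Fq K) : K[X] :=
  ∑ i ∈ f.support, C (f.coeff i) * X ^ Nat.card Fq ^ i

/-- The twisted monomial `c τ ^ n`. -/
noncomputable def monomial (n : ℕ) (c : K) : TwistedPoly Fq K := SkewPolynomial.monomial n c

theorem mem_support_iff {f : TwistedPoly Fq K} {n : ℕ} : n ∈ f.support ↔ f.coeff n ≠ 0 :=
  SkewPolynomial.mem_support_iff

theorem coeff_add (f g : TwistedPoly Fq K) (n : ℕ) : (f + g).coeff n = f.coeff n + g.coeff n :=
  congrArg (fun h => h (Multiplicative.ofAdd n)) (SkewMonoidAlgebra.coeff_add f g)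

theorem ext {f g : TwistedPoly Fq K} (h : ∀ n, f.coeff n = g.coeff n) : f = g :=
  SkewMonoidAlgebra.ext fun a => h a.toAdd

theorem coeff_monomial (m n : ℕ) (c : K) :
    (monomial m c : TwistedPoly Fq K).coeff n = if m = n then c else 0 := by
  classical
  exact (SkewMonoidAlgebra.coeff_single_apply (a := Multiplicative.ofAdd m)
    (a' := Multiplicative.ofAdd n) (b := c)).trans (by simp)

theorem monomial_zero_one : (monomial 0 1 : TwistedPoly Fq K) = 1 := rfl

theorem monomial_mul_monomial (m n : ℕ) (b c : K) :
    (monomial m b * monomial n c : TwistedPoly Fq K) =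
      monomial (m + n) (b * c ^ Nat.card Fq ^ m) :=
  letI := frobeniusAction Fq K
  SkewMonoidAlgebra.single_mul_single (k := K) (G := Multiplicative ℕ)

theorem induction_on {P : TwistedPoly Fq K → Prop} (f : TwistedPoly Fq K) (h0 : P 0)
    (hm : ∀ n c, P (monomial n c)) (ha : ∀ f g, P f → P g → P (f + g)) : P f :=
  SkewPolynomial.induction (motive := P) f h0 fun n r _ _ _ hq => ha _ _ (hm n r) hq

theorem coeff_toPoly (f : TwistedPoly Fq K) (n : ℕ) :
    (toPoly f).coeff (Nat.card Fq ^ n) = f.coeff n := by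
  have hinj := Nat.pow_right_injective (Finite.one_lt_card (α := Fq))
  simp only [toPoly, finsetSum_coeff, coeff_C_mul, coeff_X_pow]
  rw [Finset.sum_eq_single n]
  · simp
  · intro j _ hj
    rw [if_neg (fun h => hj (hinj h).symm), mul_zero]
  · intro h
    rw [mem_support_iff, not_not] at h
    rw [h, zero_mul]

theorem toPoly_injective : Function.Injective (toPoly : TwistedPoly Fq K → K[X]) := fun f g h =>
  ext fun n => by rw [← coeff_toPoly, ← coeff_toPoly, h]

theorem toPoly_eq_sum {f : TwistedPoly Fq K} {T : Finset ℕ} (h : f.support ⊆ T) :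
    toPoly f = ∑ i ∈ T, C (f.coeff i) * X ^ Nat.card Fq ^ i :=
  Finset.sum_subset h fun i _ hi => by
    rw [mem_support_iff, not_not] at hi
    rw [hi, C_0, zero_mul]

theorem toPoly_add (f g : TwistedPoly Fq K) : toPoly (f + g) = toPoly f + toPoly g := by
  classical
  have h : (f + g).support ⊆ f.support ∪ g.support := SkewPolynomial.support_add
  rw [toPoly_eq_sum h, toPoly_eq_sum (Finset.subset_union_left (s₂ := g.support)),
    toPoly_eq_sum (f := g) (Finset.subset_union_right (s₁ := f.support)), ← Finset.sum_add_distrib]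
  exact Finset.sum_congr rfl fun i _ => by rw [coeff_add, C_add, add_mul]

theorem toPoly_zero : toPoly (0 : TwistedPoly Fq K) = 0 := rfl

theorem toPoly_monomial (n : ℕ) (c : K) :
    toPoly (monomial n c : TwistedPoly Fq K) = C c * X ^ Nat.card Fq ^ n := by
  have h : (monomial n c : TwistedPoly Fq K).support ⊆ {n} := by
    intro m hm
    rw [mem_support_iff, coeff_monomial] at hm
    rw [Finset.mem_singleton]
    by_contra hne
    exact hm (if_neg fun h => hne h.symm)
  rw [toPoly_eq_sum h, Finset.sum_singleton, coeff_monomial, if_pos rfl]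

theorem toPoly_one : toPoly (1 : TwistedPoly Fq K) = X := by
  rw [← monomial_zero_one, toPoly_monomial]; simp

theorem add_pow_card {R : Type*} [CommRing R] [Algebra Fq R] [Nontrivial R] (x y : R) (n : ℕ) :
    (x + y) ^ Nat.card Fq ^ n = x ^ Nat.card Fq ^ n + y ^ Nat.card Fq ^ n := by
  have := Fintype.ofFinite Fq
  obtain ⟨m, hp, hm⟩ := FiniteField.card Fq (ringChar Fq)
  have : Fact (ringChar Fq).Prime := ⟨hp⟩
  have : CharP R (ringChar Fq) := charP_of_injective_algebraMap (algebraMap Fq R).injective _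
  rw [Nat.card_eq_fintype_card, hm, ← pow_mul]
  exact add_pow_char_pow ..

theorem toPoly_comp_add (f : TwistedPoly Fq K) (P Q : K[X]) :
    (toPoly f).comp (P + Q) = (toPoly f).comp P + (toPoly f).comp Q := by
  induction f using induction_on with
  | h0 => simp [toPoly_zero]
  | hm n c =>
    simp only [toPoly_monomial, mul_comp, C_comp, X_pow_comp]
    rw [add_pow_card (Fq := Fq), mul_add]
  | ha f g hf hg => rw [toPoly_add, add_comp, add_comp, add_comp, hf, hg]; ring

/-- Additivity reduces the claim to monomials. The lemma turns the degree of a product into the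
degree of a composition, which yields multiplicativity and the absence of zero divisors. -/
theorem toPoly_mul (f g : TwistedPoly Fq K) : toPoly (f * g) = (toPoly f).comp (toPoly g) := by
  induction f using induction_on with
  | h0 => rw [zero_mul, toPoly_zero, zero_comp]
  | ha f₁ f₂ h₁ h₂ => rw [add_mul, toPoly_add, toPoly_add, add_comp, h₁, h₂]
  | hm m b =>
    induction g using induction_on with
    | h0 =>
      rw [mul_zero, toPoly_zero, toPoly_monomial]
      simp [Nat.card_pos.ne']
    | ha g₁ g₂ h₁ h₂ => rw [mul_add, toPoly_add, toPoly_add, toPoly_comp_add, h₁, h₂]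
    | hm n c =>
      rw [monomial_mul_monomial, toPoly_monomial, toPoly_monomial, toPoly_monomial]
      simp only [mul_comp, C_comp, X_pow_comp, mul_pow, ← C_pow, ← pow_mul, C_mul]
      rw [pow_add, mul_comm (Nat.card Fq ^ m), mul_assoc]

theorem support_nonempty {f : TwistedPoly Fq K} (hf : f ≠ 0) : f.support.Nonempty :=
  Finset.nonempty_iff_ne_empty.mpr fun h => hf (SkewPolynomial.support_eq_empty.mp h)

theorem degree_eq_natDegree {f : TwistedPoly Fq K} (hf : f ≠ 0) :
    f.degree = (toPoly f).natDegree := by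
  have hq := Finite.one_lt_card (α := Fq)
  have hne := support_nonempty hf
  obtain ⟨i, hi, hsup⟩ := Finset.exists_mem_eq_sup f.support hne id
  refine le_antisymm ?_ ?_
  · rw [degree, hsup]
    refine le_natDegree_of_ne_zero ?_
    rw [id, coeff_toPoly]
    exact mem_support_iff.mp hi
  · refine natDegree_sum_le_of_forall_le _ _ fun i hi => (natDegree_C_mul_X_pow_le _ _).trans ?_
    exact Nat.pow_le_pow_right hq.le (Finset.le_sup (f := id) hi)

theorem degree_pos (f : TwistedPoly Fq K) : 0 < f.degree := pow_pos Nat.card_pos _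

theorem toPoly_ne_zero {f : TwistedPoly Fq K} (hf : f ≠ 0) : toPoly f ≠ 0 := fun h =>
  hf (toPoly_injective (h.trans toPoly_zero.symm))

instance : NoZeroDivisors (TwistedPoly Fq K) where
  eq_zero_or_eq_zero_of_mul_eq_zero {f g} h := by
    by_contra! hne
    have h1 : (toPoly f).natDegree * (toPoly g).natDegree = 0 := by
      rw [← natDegree_comp, ← toPoly_mul, h, toPoly_zero, natDegree_zero]
    rw [← degree_eq_natDegree hne.1, ← degree_eq_natDegree hne.2] at h1
    exact (Nat.mul_pos (degree_pos f) (degree_pos g)).ne' h1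

theorem degree_mul {f g : TwistedPoly Fq K} (hf : f ≠ 0) (hg : g ≠ 0) :
    (f * g).degree = f.degree * g.degree := by
  rw [degree_eq_natDegree hf, degree_eq_natDegree hg, degree_eq_natDegree (mul_ne_zero hf hg),
    toPoly_mul, natDegree_comp]

instance : Nontrivial (TwistedPoly Fq K) :=
  ⟨⟨1, 0, fun h => X_ne_zero (R := K) (by rw [← toPoly_one (Fq := Fq), h, toPoly_zero])⟩⟩

theorem degree_one : (1 : TwistedPoly Fq K).degree = 1 := by
  rw [degree_eq_natDegree one_ne_zero, toPoly_one, natDegree_X]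

theorem degree_pow {f : TwistedPoly Fq K} (hf : f ≠ 0) (n : ℕ) : (f ^ n).degree = f.degree ^ n := by
  induction n with
  | zero => rw [pow_zero, pow_zero, degree_one]
  | succ n ih => rw [pow_succ, pow_succ, degree_mul (pow_ne_zero n hf) hf, ih]

/-- A twisted polynomial of degree one is a constant. -/
theorem eq_monomial_of_degree_eq_one {f : TwistedPoly Fq K} (hf : f.degree = 1) :
    f = monomial 0 (f.coeff 0) := by
  have hq := Finite.one_lt_card (α := Fq)
  have hsup : f.support.sup id = 0 := by
    by_contra h
    exact (Nat.one_lt_pow h hq).ne' hf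
  refine ext fun n => ?_
  rw [coeff_monomial]
  split_ifs with h
  · rw [h]
  · by_contra hn
    have := Finset.le_sup (f := id) (mem_support_iff.mpr hn)
    rw [hsup] at this
    exact h (Nat.le_zero.mp this).symm

section Eval

variable {L : Type*} [Field L] [Algebra K L]

theorem eval_eq (f : TwistedPoly Fq K) (x : L) :
    f.eval x = ((toPoly f).map (algebraMap K L)).eval x := by
  simp only [eval, toPoly, eval_map, eval₂_finsetSum, eval₂_mul, eval₂_C, eval₂_X_pow]

theorem eval_mul (f g : TwistedPoly Fq K) (x : L) : (f * g).eval x = f.eval (g.eval x) := by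
  rw [eval_eq, eval_eq, eval_eq, toPoly_mul, Polynomial.map_comp, eval_comp]

theorem eval_one (x : L) : (1 : TwistedPoly Fq K).eval x = x := by
  rw [eval_eq, toPoly_one, map_X, eval_X]

theorem eval_pow (f : TwistedPoly Fq K) (n : ℕ) (x : L) :
    (f ^ n).eval x = f.eval^[n] x := by
  induction n with
  | zero => rw [pow_zero, eval_one, Function.iterate_zero, id]
  | succ n ih => rw [pow_succ', eval_mul, ih, Function.iterate_succ_apply']

variable [Algebra Fq L] [IsScalarTower Fq K L]

/-- The evaluation of a twisted polynomial as a linear map. -/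
noncomputable def evalLinear (f : TwistedPoly Fq K) : L →ₗ[Fq] L where
  toFun := f.eval
  map_add' x y := by
    simp only [eval, add_pow_card (Fq := Fq), mul_add, Finset.sum_add_distrib]
  map_smul' c x := by
    simp only [eval, Finset.smul_sum, RingHom.id_apply]
    refine Finset.sum_congr rfl fun i _ => ?_
    have : c ^ Nat.card Fq ^ i = c := by
      have := Fintype.ofFinite Fq
      rw [Nat.card_eq_fintype_card, FiniteField.pow_card_pow]
    rw [_root_.smul_pow, this, mul_smul_comm]

end Eval

theorem monomial_zero_pow (c : K) (n : ℕ) :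
    (monomial 0 c : TwistedPoly Fq K) ^ n = monomial 0 (c ^ n) := by
  induction n with
  | zero => rw [pow_zero, pow_zero, monomial_zero_one]
  | succ n ih => rw [pow_succ, pow_succ, ih, monomial_mul_monomial]; simp

theorem eval_monomial_zero {L : Type*} [Field L] [Algebra K L] (c : K) (x : L) :
    (monomial 0 c : TwistedPoly Fq K).eval x = algebraMap K L c * x := by
  rw [eval_eq, toPoly_monomial]; simp

theorem eval_zero {L : Type*} [Field L] [Algebra K L] (x : L) :
    (0 : TwistedPoly Fq K).eval x = 0 := by
  rw [eval_eq, toPoly_zero]; simp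

theorem degree_eq_one_of_pow_eq_one {f : TwistedPoly Fq K} {k : ℕ} (hk : k ≠ 0) (h : f ^ k = 1) :
    f.degree = 1 := by
  have hf : f ≠ 0 := fun h0 => by
    rw [h0, zero_pow hk] at h
    exact zero_ne_one h
  have h1 := degree_pow hf k
  rw [h, degree_one] at h1
  exact (pow_eq_one_iff_of_nonneg (Nat.zero_le _) hk).mp h1.symm

theorem mem_support_toPoly {f : TwistedPoly Fq K} {j : ℕ} (hj : j ∈ (toPoly f).support) :
    ∃ i ∈ f.support, j = Nat.card Fq ^ i := by
  by_contra! h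
  rw [Polynomial.mem_support_iff] at hj
  refine hj ?_
  simp only [toPoly, finsetSum_coeff, coeff_C_mul, coeff_X_pow]
  exact Finset.sum_eq_zero fun i hi => by rw [if_neg (h i hi), mul_zero]

end TwistedPoly

/-! ### Algebraic dependence modulo a nonzero element -/

/-- An algebraic element over a finite field has two equal powers. -/
theorem exists_pow_eq_pow_of_isAlgebraic {Fq : Type*} [Field Fq] [Finite Fq] {B : Type*}
    [CommRing B] [Algebra Fq B] {b : B} (hb : IsAlgebraic Fq b) : ∃ m n, m < n ∧ b ^ m = b ^ n := by
  have hfg : Module.Finite Fq (Algebra.adjoin Fq {b}) :=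
    Module.Finite.iff_fg.mpr hb.isIntegral.fg_adjoin_singleton
  have : Finite (Algebra.adjoin Fq {b}) := Module.finite_of_finite Fq
  have hmem : b ∈ Algebra.adjoin Fq {b} := Algebra.self_mem_adjoin_singleton Fq b
  obtain ⟨m, n, hne, h⟩ := Finite.exists_ne_map_eq_of_infinite
    fun n : ℕ => (⟨b, hmem⟩ : Algebra.adjoin Fq {b}) ^ n
  have h' : b ^ m = b ^ n := congrArg Subtype.val h
  rcases lt_or_gt_of_ne hne with hlt | hlt
  · exact ⟨m, n, hlt, h'⟩
  · exact ⟨n, m, hlt, h'.symm⟩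

open Polynomial in
/-- Modulo a nonzero element `s` of a domain of transcendence degree at most one, every element is
algebraic over the base field. -/
theorem exists_dvd_aeval {k A : Type*} [Field k] [CommRing A] [IsDomain A] [Algebra k A]
    {s a : A} (hs : s ≠ 0) (hdep : ¬ AlgebraicIndependent k ![a, s]) :
    ∃ Q : k[X], Q ≠ 0 ∧ s ∣ aeval a Q := by
  rw [algebraicIndependent_iff] at hdep
  push Not at hdep
  obtain ⟨p, hp, hp0⟩ := hdep
  -- The relation between `a` and `s` is read as a polynomial in `a` with coefficients in `k[s]`;
  -- the inner variable stands for `s`.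
  let ev : k[X][X] →+* A := eval₂RingHom (aeval s : k[X] →ₐ[k] A).toRingHom a
  obtain ⟨P, hP0, hP⟩ : ∃ P : k[X][X], P ≠ 0 ∧ ev P = 0 := by
    let e : MvPolynomial (Fin 2) k →ₐ[k] k[X][X] := MvPolynomial.aeval ![X, C X]
    refine ⟨e p, ?_, ?_⟩
    · intro h
      let e' : k[X][X] →+* MvPolynomial (Fin 2) k :=
        eval₂RingHom (aeval (MvPolynomial.X 1) : k[X] →ₐ[k] MvPolynomial (Fin 2) k).toRingHom
          (MvPolynomial.X 0)
      have h1 : e'.comp e.toRingHom = RingHom.id _ := by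
        refine MvPolynomial.ringHom_ext (fun c => ?_) fun j => ?_
        · simp [e, e', MvPolynomial.algebraMap_eq]
        · fin_cases j <;> simp [e, e']
      have h2 := congrArg (fun g : _ →+* _ => g p) h1
      simp only [RingHom.comp_apply, RingHom.id_apply] at h2
      rw [show e.toRingHom p = 0 from h, map_zero] at h2
      exact hp0 h2.symm
    · have h1 : ev.comp e.toRingHom = (MvPolynomial.aeval ![a, s] : _ →ₐ[k] A).toRingHom := by
        refine MvPolynomial.ringHom_ext (fun c => ?_) fun j => ?_
        · simp [e, ev]
        · fin_cases j <;> simp [e, ev]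
      have h2 := congrArg (fun g : _ →+* _ => g p) h1
      exact h2.trans hp
  have hXprime : Prime (C X : k[X][X]) := prime_C_iff.mpr prime_X
  -- After cancelling the largest power of `s` the relation stays nonzero when the inner variable is
  -- set to `0`, and this specialization is `Q`.
  obtain ⟨n, P', hndvd, rfl⟩ := WfDvdMonoid.max_power_factor hP0 hXprime.irreducible
  have hP' : ev P' = 0 := by
    rw [map_mul, map_pow] at hP
    have : ev (C X) = s := by simp [ev]
    rw [this] at hP
    exact (mul_eq_zero.mp hP).resolve_left (pow_ne_zero n hs)
  refine ⟨P'.map (constantCoeff : k[X] →+* k), ?_, ?_⟩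
  · intro h
    refine hndvd ((C_dvd_iff_dvd_coeff X P').mpr fun j => ?_)
    have := congrArg (fun g => coeff g j) h
    simp only [coeff_map, coeff_zero] at this
    exact X_dvd_iff.mpr this
  · have h1 : (Ideal.Quotient.mk (Ideal.span {s})) (aeval a (P'.map (constantCoeff : k[X] →+* k))) =
        Ideal.Quotient.mk (Ideal.span {s}) (ev P') := by
      have hcoe : ∀ c : k[X], Ideal.Quotient.mk (Ideal.span {s}) (aeval s c) =
          Ideal.Quotient.mk (Ideal.span {s}) (algebraMap k A (constantCoeff c)) := by
        intro c
        rw [Ideal.Quotient.eq, Ideal.mem_span_singleton]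
        obtain ⟨d, hd⟩ : X ∣ c - C (constantCoeff c) := X_dvd_iff.mpr (by simp)
        refine ⟨aeval s d, ?_⟩
        have := congrArg (aeval s) hd
        simpa using this
      simp only [ev, coe_eval₂RingHom, eval₂_eq_sum, sum_def, map_sum, map_mul, map_pow]
      rw [aeval_eq_sum_range' (n := P'.natDegree + 1) (lt_of_le_of_lt natDegree_map_le (by omega))]
      rw [map_sum]
      have h2 : P'.support ⊆ Finset.range (P'.natDegree + 1) := supp_subset_range (by omega)
      rw [Finset.sum_subset h2 fun j _ hj => by
        rw [notMem_support_iff.mp hj, map_zero, map_zero, zero_mul]]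
      refine Finset.sum_congr rfl fun j _ => ?_
      rw [coeff_map, Algebra.smul_def, map_mul, map_pow]
      congr 1
      exact (hcoe _).symm
    rw [hP', map_zero, Ideal.Quotient.eq_zero_iff_mem, Ideal.mem_span_singleton] at h1
    exact h1

/-! ### Local heights of a Drinfeld module as canonical heights -/

namespace DrinfeldModule

open TwistedPoly

variable {Fq : Type*} [Field Fq] [Finite Fq] {A : Type*} [CommRing A] [Algebra Fq A]
  {K : Type*} [Field K] [Algebra Fq K] {i : A →ₐ[Fq] K} (φ : DrinfeldModule Fq i)

/-- If `φ` is not injective, then every `φ_a` is zero or a root of unity. -/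
theorem eq_zero_or_pow_eq_one [IsDomain A] {s : A} (hs : s ≠ 0) (hφs : φ.toRingHom s = 0) {a : A}
    (hdep : ¬ AlgebraicIndependent Fq ![a, s]) :
    φ.toRingHom a = 0 ∨ ∃ k ≠ 0, φ.toRingHom a ^ k = 1 := by
  -- `φ` factors through the quotient by `s`, where `a` is algebraic over a finite field and so has
  -- two equal powers. These can be cancelled because `K{τ}` has no zero divisors.
  obtain ⟨Q, hQ, hdvd⟩ := exists_dvd_aeval hs hdep
  have halg : IsAlgebraic Fq (Ideal.Quotient.mk (Ideal.span {s}) a) := by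
    refine ⟨Q, hQ, ?_⟩
    have := Polynomial.aeval_algHom_apply (Ideal.Quotient.mkₐ Fq (Ideal.span {s})) a Q
    refine this.trans ?_
    rw [Ideal.Quotient.mkₐ_eq_mk, Ideal.Quotient.eq_zero_iff_mem, Ideal.mem_span_singleton]
    exact hdvd
  obtain ⟨m, n, hlt, h⟩ := exists_pow_eq_pow_of_isAlgebraic halg
  rw [← map_pow, ← map_pow, Ideal.Quotient.eq, Ideal.mem_span_singleton] at h
  obtain ⟨d, hd⟩ := h
  have h1 : φ.toRingHom a ^ m = φ.toRingHom a ^ n := by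
    rw [← sub_eq_zero, ← map_pow, ← map_pow, ← map_sub, hd, map_mul, hφs, zero_mul]
  by_cases ha : φ.toRingHom a = 0
  · exact Or.inl ha
  · refine Or.inr ⟨n - m, by omega, ?_⟩
    apply mul_left_cancel₀ (pow_ne_zero m ha)
    rw [← pow_add, Nat.add_sub_cancel' hlt.le, mul_one, h1]

/-- If `φ` is injective and of finite characteristic, then `φ_a` is nonconstant for every
nonconstant `a`. -/
theorem one_lt_degree (hinj : Function.Injective φ.toRingHom) {t : A} (ht : t ≠ 0) (hit : i t = 0)
    {a : A} (ha : ¬ IsAlgebraic Fq a) : 1 < (φ.toRingHom a).degree := by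
  have hq := Finite.one_lt_card (α := Fq)
  refine lt_of_le_of_ne (degree_pos _) fun h => ha ?_
  have hφa := eq_monomial_of_degree_eq_one h.symm
  set α := (φ.toRingHom a).coeff 0
  have hφt : φ.toRingHom t ≠ 0 := fun h0 => ht (hinj (h0.trans (map_zero _).symm))
  obtain ⟨r, hr⟩ := support_nonempty hφt
  rw [mem_support_iff] at hr
  have hr0 : r ≠ 0 := fun h0 => hr (by rw [h0, φ.coeff_zero, hit])
  have hcomm : φ.toRingHom t * monomial 0 α = monomial 0 α * φ.toRingHom t := by
    rw [← hφa, ← map_mul, ← map_mul, mul_comm]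
  have h1 := congrArg (fun f => (toPoly f).coeff (Nat.card Fq ^ r)) hcomm
  simp only [toPoly_mul, toPoly_monomial, pow_zero, pow_one] at h1
  -- Comparing the coefficients of `X ^ (q ^ r)` in `φ_t α = α φ_t` gives `α ^ (q ^ r) = α`, with `r
  -- ≠ 0` because `φ_t` has no constant term. By injectivity `a` satisfies the same equation.
  rw [Polynomial.comp_C_mul_X_coeff, Polynomial.mul_comp, Polynomial.C_comp, Polynomial.X_comp,
    Polynomial.coeff_C_mul, coeff_toPoly, mul_comm α] at h1
  have hα := mul_left_cancel₀ hr h1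
  have h2 : a ^ Nat.card Fq ^ r = a := hinj (by
    rw [map_pow, hφa, monomial_zero_pow, hα])
  refine ⟨Polynomial.X ^ Nat.card Fq ^ r - Polynomial.X, ?_, by simp [h2]⟩
  exact FiniteField.X_pow_card_pow_sub_X_ne_zero Fq hr0 hq

variable {L : Type*} [Field L] [Algebra K L]

theorem unweightedLocalHeight_of_degenerate {w : ValuationSubring L}
    {v : Valuation L (WithZero (Multiplicative ℤ))}
    (hw : ∀ y, truncatedOrd w y = -logPlus v y) {a : A}
    (ha : φ.toRingHom a = 0 ∨ ∃ k ≠ 0, φ.toRingHom a ^ k = 1) (x : L) :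
    ∃ n : ℤ, φ.unweightedLocalHeight a w x = n := by
  rcases ha with ha | ⟨k, hk, ha⟩
  · refine ⟨0, Tendsto.limUnder_eq ?_⟩
    refine tendsto_const_nhds.congr' ?_
    -- At `n = 0` the map is `φ_1 = 1`, so the sequence vanishes only from `n = 1` on.
    filter_upwards [eventually_ne_atTop 0] with n hn
    rw [map_pow, ha, zero_pow hn, TwistedPoly.eval_zero, hw]
    simp [logPlus]
  · refine ⟨-logPlus v x, Tendsto.limUnder_eq ?_⟩
    refine tendsto_const_nhds.congr fun n => ?_
    have h1 : (φ.toRingHom (a ^ n)) ^ k = 1 := by rw [map_pow, pow_right_comm, ha, one_pow]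
    have hdeg := degree_eq_one_of_pow_eq_one hk h1
    have hmon := eq_monomial_of_degree_eq_one hdeg
    set β := (φ.toRingHom (a ^ n)).coeff 0
    -- Each `φ_{a ^ n}` is multiplication by a root of unity, which does not change the valuation;
    -- the sequence is constant.
    have hβ : β ^ k = 1 := by
      rw [hmon, monomial_zero_pow, ← monomial_zero_one] at h1
      have := congrArg (fun f => TwistedPoly.coeff f 0) h1
      simpa [coeff_monomial] using this
    have hvβ : v (algebraMap K L β) = 1 := by
      refine (pow_eq_one_iff_of_nonneg zero_le hk).mp ?_
      rw [← map_pow, ← map_pow, hβ, map_one, map_one]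
    rw [hdeg, hmon, eval_monomial_zero, hw, logPlus, logPlus, map_mul, hvβ, one_mul]
    simp

open WithZero in
/-- The lower bound for the local height in terms of the valuation, for injective `φ`. -/
theorem div_pow_le_neg_unweightedLocalHeight [Algebra Fq L] [IsScalarTower Fq K L]
    (hinj : Function.Injective φ.toRingHom) {t : A} (ht : t ≠ 0) (hit : i t = 0)
    {w : ValuationSubring L} {v : Valuation L (WithZero (Multiplicative ℤ))}
    (hw : ∀ y, truncatedOrd w y = -logPlus v y) {E₀ e : ℕ} (he : 1 ≤ e)
    (hE : ∀ j, |log (v (algebraMap K L ((φ.toRingHom t).coeff j)))| ≤ E₀ * e)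
    {a : A} (ha : ¬ IsAlgebraic Fq a) {x : L} (hx : 0 < -φ.unweightedLocalHeight a w x) :
    (((Nat.card Fq : ℝ) ^ 3 * (E₀ * (2 * (φ.toRingHom t).degree + 2) + 1)) ^
        ((φ.toRingHom t).support.sup id * (((φ.toRingHom t).support ×ˢ
          (φ.toRingHom t).support).card * (φ.toRingHom t).support.sup id + 1)))⁻¹ /
      (e : ℝ) ^ ((φ.toRingHom t).support.sup id * (((φ.toRingHom t).support ×ˢ
          (φ.toRingHom t).support).card * (φ.toRingHom t).support.sup id + 1)) ≤
      -φ.unweightedLocalHeight a w x := by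
  have hq := Finite.one_lt_card (α := Fq)
  have hinjKL := (algebraMap K L).injective
  set T := φ.toRingHom t with hT
  have hT0 : T ≠ 0 := fun h0 => ht (hinj (h0.trans (map_zero _).symm))
  have hcoeff0 : T.coeff 0 = 0 := by rw [hT, φ.coeff_zero, hit]
  have h0S : 0 ∉ T.support := fun h => mem_support_iff.mp h hcoeff0
  obtain ⟨r, hr⟩ := support_nonempty hT0
  have hdeg : 2 ≤ T.degree := by
    have h1 : T.support.sup id ≠ 0 := by
      have := Finset.le_sup (f := id) hr
      have hr0 : r ≠ 0 := fun h => h0S (h ▸ hr)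
      simp only [id] at this
      omega
    exact hq.trans_le (Nat.le_self_pow h1 _)
  have hbound : ∀ (f : TwistedPoly Fq K), f ≠ 0 → ∀ E : ℕ,
      (∀ j, |log (v (algebraMap K L (f.coeff j)))| ≤ E) → ∀ y : L,
      |(logPlus v (f.eval y) : ℝ) - f.degree * logPlus v y| ≤ E * (2 * f.degree + 1) := by
    intro f hf E hfE y
    have hP : (toPoly f).map (algebraMap K L) ≠ 0 :=
      (Polynomial.map_ne_zero_iff hinjKL).mpr (toPoly_ne_zero hf)
    have := abs_logPlus_eval_sub_le v _ hP (E := E) (by positivity) (fun j hj => by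
      rw [Polynomial.support_map_of_injective _ hinjKL] at hj
      obtain ⟨l, -, rfl⟩ := mem_support_toPoly hj
      rw [Polynomial.coeff_map, coeff_toPoly]
      exact hfE l) y
    rw [Polynomial.natDegree_map, ← degree_eq_natDegree hf] at this
    rw [eval_eq]
    exact_mod_cast this
  obtain ⟨h, H⟩ := exists_isCanonicalHeight (T.eval (L := L)) (D := T.degree)
    (by exact_mod_cast hdeg) (fun y => (logPlus v y : ℝ)) (c := E₀ * e * (2 * T.degree + 1))
    (by
      have := hbound T hT0 (E₀ * e) (fun j => by push_cast; exact hE j)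
      exact_mod_cast this)
  -- The height was built from `t`. Commutativity of `A` identifies it with the limit formed with
  -- `a`, whose degree exceeds one.
  have hlim : φ.unweightedLocalHeight a w x = -h x := by
    set g := φ.toRingHom a with hg
    have hdega : 1 < g.degree := φ.one_lt_degree hinj ht hit ha
    have hg0 : g ≠ 0 := fun h0 => ha (by
      rw [hinj (h0.trans (map_zero _).symm)]; exact isAlgebraic_zero)
    obtain ⟨E, hEg⟩ : ∃ E : ℕ, ∀ j, |log (v (algebraMap K L (g.coeff j)))| ≤ E := by
      refine ⟨∑ j ∈ g.support, (log (v (algebraMap K L (g.coeff j)))).natAbs, fun j => ?_⟩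
      by_cases hj : j ∈ g.support
      · rw [Int.abs_eq_natAbs, Int.ofNat_le]
        exact Finset.single_le_sum
          (f := fun j => (log (v (algebraMap K L (g.coeff j)))).natAbs) (by simp) hj
      · rw [mem_support_iff, not_not] at hj
        simp only [hj, map_zero, log_zero, abs_zero]
        positivity
    have htend := H.tendsto_of_commute (g := g.eval (L := L)) (d := g.degree)
      (by exact_mod_cast hdega) (hbound g hg0 E hEg)
      (fun y => by rw [← eval_mul, ← eval_mul, hg, hT, ← map_mul, ← map_mul, mul_comm]) x
    refine Tendsto.limUnder_eq (htend.neg.congr fun n => ?_)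
    rw [map_pow, ← hg, eval_pow, degree_pow hg0, hw]
    push_cast
    rw [neg_div]
  rw [hlim, neg_neg] at hx ⊢
  have hf : ∀ y : L, evalLinear T y = ∑ j ∈ T.support, algebraMap K L (T.coeff j) *
      y ^ Nat.card Fq ^ j := fun _ => rfl
  exact IsCanonicalHeight.div_pow_le (f := evalLinear T) h0S hf
    (fun j hj => (map_ne_zero_iff _ hinjKL).mpr (mem_support_iff.mp hj))
    (by rw [TwistedPoly.degree]; push_cast; rfl) he H
    (fun j _ => (le_abs_self _).trans (hE j)) hx

end DrinfeldModule

/-! ### Normalized valuations of discrete valuation rings -/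

section Discrete

open WithZero

variable {L : Type*} [Field L]

/-- The normalized valuation of a discrete valuation ring of `L`. -/
noncomputable def dvrValuation (w : ValuationSubring L) [IsDiscreteValuationRing w] :
    Valuation L (WithZero (Multiplicative ℤ)) :=
  (IsDiscreteValuationRing.maximalIdeal w).valuation L

variable (w : ValuationSubring L) [IsDiscreteValuationRing w]

theorem dvrValuation_le_one_iff {y : L} : dvrValuation w y ≤ 1 ↔ y ∈ w := by
  constructor
  · intro h
    obtain ⟨a, rfl⟩ := IsDiscreteValuationRing.exists_lift_of_le_one h
    exact a.2
  · exact fun h => (IsDiscreteValuationRing.maximalIdeal w).valuation_le_one (K := L) ⟨y, h⟩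

theorem dvrValuation_le_exp_iff {y : w} {n : ℕ} :
    dvrValuation w y ≤ exp (-(n : ℤ)) ↔ y ∈ IsLocalRing.maximalIdeal w ^ n := by
  have h := (IsDiscreteValuationRing.maximalIdeal w).valuation_of_algebraMap (K := L) y
  have h' : dvrValuation w y = (IsDiscreteValuationRing.maximalIdeal w).intValuation y := h
  rw [h']
  exact (IsDiscreteValuationRing.maximalIdeal w).intValuation_le_pow_iff_mem y n

theorem dvrValuation_irreducible {ϖ : w} (hϖ : Irreducible ϖ) :
    dvrValuation w ϖ = exp (-1 : ℤ) := by
  have h := (IsDiscreteValuationRing.maximalIdeal w).valuation_of_algebraMap (K := L) ϖ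
  have h' : dvrValuation w ϖ = (IsDiscreteValuationRing.maximalIdeal w).intValuation ϖ := h
  rw [h']
  exact (IsDiscreteValuationRing.maximalIdeal w).intValuation_singleton hϖ.ne_zero
    hϖ.maximalIdeal_eq

theorem dvrValuation_unit {y : L} (hy : y ≠ 0) (h : y ∈ w) (h' : y⁻¹ ∈ w) :
    dvrValuation w y = 1 :=
  le_antisymm ((dvrValuation_le_one_iff w).mpr h)
    (((dvrValuation w).one_le_val_iff hy).mpr ((dvrValuation_le_one_iff w).mpr h'))

theorem truncatedOrd_eq (y : L) : truncatedOrd w y = -logPlus (dvrValuation w) y := by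
  unfold truncatedOrd
  split_ifs with h
  · have : logPlus (dvrValuation w) y ≤ 0 :=
      (logPlus_le_iff _ le_rfl).mpr ((dvrValuation_le_one_iff w).mpr h)
    have := logPlus_nonneg (dvrValuation w) y
    omega
  · have hy : y ≠ 0 := fun h0 => h (h0 ▸ w.zero_mem)
    have h1 : 1 < dvrValuation w y := not_le.mp fun h1 => h ((dvrValuation_le_one_iff w).mp h1)
    have hv : dvrValuation w y ≠ 0 := (dvrValuation w).ne_zero_iff.mpr hy
    have hlog : 0 < log (dvrValuation w y) := (lt_log_iff_exp_lt hv).mpr h1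
    have hl : logPlus (dvrValuation w) y = log (dvrValuation w y) := max_eq_right hlog.le
    rw [hl, neg_inj]
    obtain ⟨N, hN⟩ := Int.eq_ofNat_of_zero_le hlog.le
    rw [hN, Nat.cast_inj]
    -- The supremum in `ordOfMem` is meaningful only for a bounded set of exponents, so its maximum
    -- is exhibited.
    refine IsGreatest.csSup_eq (a := N) ?_
    have hinv : dvrValuation w y⁻¹ = exp (-(N : ℤ)) := by
      rw [map_inv₀, ← exp_log hv, hN, exp_neg]
    refine ⟨(dvrValuation_le_exp_iff w).mp hinv.le, fun n hn => ?_⟩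
    have h2 := (dvrValuation_le_exp_iff w).mpr hn
    change dvrValuation w y⁻¹ ≤ _ at h2
    rw [hinv, exp_le_exp] at h2
    omega

end Discrete

/-! ### Discrete valuation rings in finite extensions -/

section FiniteExtension

variable {K : Type*} [Field K] {L : Type*} [Field L] [Algebra K L]

/-- Among more than `[L : K]` elements of `L`, two have values that differ by a value of `K`. -/
theorem exists_valuation_eq_mul [FiniteDimensional K L] {Γ : Type*}
    [LinearOrderedCommGroupWithZero Γ] (v : Valuation L Γ) {n : ℕ} (hn : Module.finrank K L < n)
    (y : Fin n → L) (hy : ∀ i, y i ≠ 0) :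
    ∃ i j, i < j ∧ ∃ c : K, c ≠ 0 ∧ v (y j) = v (algebraMap K L c) * v (y i) := by
  classical
  have hdep : ¬ LinearIndependent K y := fun h => by
    have := h.fintype_card_le_finrank
    rw [Fintype.card_fin] at this
    omega
  rw [Fintype.not_linearIndependent_iff] at hdep
  obtain ⟨b, hsum, k, hk⟩ := hdep
  simp only [Algebra.smul_def] at hsum
  have hne : ∀ i, b i ≠ 0 → v (algebraMap K L (b i)) ≠ 0 := fun i h =>
    v.ne_zero_iff.mpr ((map_ne_zero _).mpr h)
  -- In a vanishing nontrivial combination the largest value must be attained at least twice.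
  obtain ⟨i, hi, hmax⟩ := Finset.exists_max_image Finset.univ
    (fun i => v (algebraMap K L (b i) * y i)) ⟨k, Finset.mem_univ k⟩
  have hbi : b i ≠ 0 := fun h0 => by
    have h1 := hmax k (Finset.mem_univ k)
    simp only [h0, map_zero, zero_mul] at h1
    exact v.ne_zero_iff.mpr (mul_ne_zero ((map_ne_zero (algebraMap K L)).mpr hk) (hy k))
      (le_zero_iff.mp h1)
  obtain ⟨j, hji, heq⟩ : ∃ j, j ≠ i ∧
      v (algebraMap K L (b j) * y j) = v (algebraMap K L (b i) * y i) := by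
    by_contra! hcon
    have h1 := v.map_sum_eq_of_lt (f := fun i => algebraMap K L (b i) * y i) hi fun j hj => by
      rw [Finset.mem_sdiff, Finset.mem_singleton] at hj
      exact lt_of_le_of_ne (hmax j hj.1) (hcon j hj.2)
    rw [hsum, map_zero] at h1
    exact v.ne_zero_iff.mpr (mul_ne_zero ((map_ne_zero (algebraMap K L)).mpr hbi) (hy i)) h1.symm
  have hbj : b j ≠ 0 := fun h0 => by
    rw [h0, map_zero, zero_mul, map_zero] at heq
    exact v.ne_zero_iff.mpr (mul_ne_zero ((map_ne_zero (algebraMap K L)).mpr hbi) (hy i)) heq.symm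
  have key : ∀ i j, b i ≠ 0 → b j ≠ 0 →
      v (algebraMap K L (b j) * y j) = v (algebraMap K L (b i) * y i) →
      v (y j) = v (algebraMap K L (b i / b j)) * v (y i) := by
    intro i j hbi hbj heq
    rw [map_mul, map_mul] at heq
    rw [map_div₀, map_div₀, div_mul_eq_mul_div, eq_div_iff (hne j hbj), ← heq, mul_comm]
  rcases lt_or_gt_of_ne hji with hlt | hlt
  · exact ⟨j, i, hlt, b j / b i, div_ne_zero hbj hbi, key j i hbj hbi heq.symm⟩
  · exact ⟨i, j, hlt, b i / b j, div_ne_zero hbi hbj, key i j hbi hbj heq⟩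

theorem mem_below_iff (w : ValuationSubring L) (c : K) : c ∈ below K w ↔ algebraMap K L c ∈ w :=
  Iff.rfl

section

variable (w : ValuationSubring L)

theorem valuation_uniformizer_lt_one {ϖ : below K w} (hϖ : Irreducible ϖ) {Γ : Type*}
    [LinearOrderedCommGroupWithZero Γ] (v : Valuation L Γ) (hv : ∀ y, v y ≤ 1 ↔ y ∈ w) :
    v (algebraMap K L (ϖ : K)) < 1 := by
  have h0 : (ϖ : K) ≠ 0 := fun h => hϖ.ne_zero (Subtype.ext h)
  rw [v.val_lt_one_iff ((map_ne_zero _).mpr h0)]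
  by_contra! h
  rw [hv, ← map_inv₀] at h
  refine hϖ.not_isUnit (isUnit_iff_exists_inv.mpr ⟨⟨(ϖ : K)⁻¹, h⟩, Subtype.ext ?_⟩)
  exact mul_inv_cancel₀ h0

variable [IsDiscreteValuationRing (below K w)]

theorem valuation_algebraMap_zpow {ϖ : below K w} (hϖ : Irreducible ϖ) {Γ : Type*}
    [LinearOrderedCommGroupWithZero Γ] (v : Valuation L Γ) (hv : ∀ y, v y ≤ 1 ↔ y ∈ w)
    {c : K} (hc : c ≠ 0) : ∃ n : ℤ, v (algebraMap K L c) = v (algebraMap K L (ϖ : K)) ^ n ∧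
      dvrValuation (below K w) c = dvrValuation (below K w) ϖ ^ n := by
  obtain ⟨n, u, rfl⟩ :=
    IsDiscreteValuationRing.exists_units_eq_smul_zpow_of_irreducible (K := K) hϖ hc
  have hu1 : ((u : below K w) : K) ∈ below K w := (u : below K w).2
  have hu2 : ((u : below K w) : K)⁻¹ ∈ below K w := by
    have h1 : ((u : below K w) : K) * ((u⁻¹ : (below K w)ˣ) : below K w) = 1 := by
      exact_mod_cast congrArg (Subtype.val : below K w → K) u.mul_inv
    rw [inv_eq_of_mul_eq_one_right h1]
    exact ((u⁻¹ : (below K w)ˣ) : below K w).2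
  have hu0 : ((u : below K w) : K) ≠ 0 := by simp
  have hvu : v (algebraMap K L ((u : below K w) : K)) = 1 := by
    refine le_antisymm ((hv _).mpr hu1) ?_
    refine (v.one_le_val_iff ((map_ne_zero _).mpr hu0)).mpr ((hv _).mpr ?_)
    rw [← map_inv₀]
    exact hu2
  refine ⟨n, ?_, ?_⟩
  · rw [Units.smul_def, Algebra.smul_def, map_mul, map_mul, map_zpow₀, map_zpow₀]
    change v (algebraMap K L ((u : below K w) : K)) * _ = _
    rw [hvu, one_mul]
    rfl
  · rw [Units.smul_def, Algebra.smul_def, map_mul, map_zpow₀]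
    change dvrValuation (below K w) ((u : below K w) : K) * _ = _
    rw [dvrValuation_unit _ hu0 hu1 hu2, one_mul]
    rfl

/-- A valuation ring of a finite extension that lies over a discrete valuation ring is discrete. -/
theorem isDiscreteValuationRing_of_below [FiniteDimensional K L] : IsDiscreteValuationRing w := by
  classical
  obtain ⟨π, hπ⟩ := IsDiscreteValuationRing.exists_irreducible (below K w)
  set v := w.valuation with hvdef
  have hv : ∀ y, v y ≤ 1 ↔ y ∈ w := w.valuation_le_one_iff
  set g := v (algebraMap K L (π : K)) with hg
  have hg1 : g < 1 := valuation_uniformizer_lt_one w hπ v hv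
  have hπ0 : algebraMap K L (π : K) ≠ 0 :=
    (map_ne_zero _).mpr fun h => hπ.ne_zero (Subtype.ext h)
  have hg0 : 0 < g := zero_lt_iff.mpr (v.ne_zero_iff.mpr hπ0)
  have hzpow : ∀ c : K, c ≠ 0 → ∃ n : ℤ, v (algebraMap K L c) = g ^ n := fun c hc =>
    (valuation_algebraMap_zpow w hπ v hv hc).imp fun _ h => h.1
  -- the values between the value of `π` and `1`
  let T : Set w.ValueGroup := {γ | g < γ ∧ γ ≤ 1}
  -- Among more than `[L : K]` values in this interval, two differ by a power of `g`. The exponent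
  -- `0` makes them equal, and any other exponent leaves the interval.
  have hT : T.Finite := by
    by_contra hinf
    let emb := Set.Infinite.natEmbedding T hinf
    choose y hy using fun k : Fin (Module.finrank K L + 1) => w.valuation_surjective (emb k).1
    have hy0 : ∀ k, y k ≠ 0 := fun k h0 => by
      have h1 := hy k
      rw [h0, map_zero] at h1
      have h2 := (emb k).2.1
      rw [← h1] at h2
      exact absurd h2 (not_lt.mpr hg0.le)
    obtain ⟨i, j, hij, c, hc, heq⟩ := exists_valuation_eq_mul v (Nat.lt_succ_self _) y hy0
    obtain ⟨n, hn⟩ := hzpow c hc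
    have hi := (emb i).2
    have hj := (emb j).2
    rw [hn] at heq
    rw [hy i, hy j] at heq
    rcases lt_trichotomy n 0 with hn0 | rfl | hn0
    · have h1 : (emb i).1 ≤ g := by
        have h2 : (emb i).1 = g ^ (-n) * (emb j).1 := by
          rw [heq, ← mul_assoc, ← zpow_add₀ hg0.ne']; simp
        rw [h2]
        calc g ^ (-n) * (emb j).1 ≤ g ^ (1 : ℤ) * 1 :=
              mul_le_mul' (zpow_le_zpow_right_of_le_one₀ hg0 hg1.le (by omega)) hj.2
          _ = g := by simp
      exact absurd hi.1 (not_lt.mpr h1)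
    · rw [zpow_zero, one_mul] at heq
      have h1 := emb.injective (Subtype.ext heq)
      exact hij.ne (Fin.ext h1.symm)
    · have h1 : (emb j).1 ≤ g := by
        rw [heq]
        calc g ^ n * (emb i).1 ≤ g ^ (1 : ℤ) * 1 :=
              mul_le_mul' (zpow_le_zpow_right_of_le_one₀ hg0 hg1.le (by omega)) hi.2
          _ = g := by simp
      exact absurd hj.1 (not_lt.mpr h1)
  obtain ⟨γ, hγ1, hgγ, hγmax⟩ : ∃ γ : w.ValueGroup, γ < 1 ∧ g ≤ γ ∧ ∀ δ < 1, δ ≤ γ := by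
    have hfin : (insert g (T ∩ {γ | γ < 1})).Finite := (hT.subset Set.inter_subset_left).insert g
    obtain ⟨γ, hγ, hmax⟩ := Set.exists_max_image _ id hfin ⟨g, Set.mem_insert _ _⟩
    refine ⟨γ, ?_, hmax g (Set.mem_insert _ _), fun δ hδ => ?_⟩
    · rcases hγ with rfl | hγ
      · exact hg1
      · exact hγ.2
    · by_cases h : g < δ
      · exact hmax δ (Set.mem_insert_of_mem _ ⟨⟨h, hδ.le⟩, hδ⟩)
      · exact (not_lt.mp h).trans (hmax g (Set.mem_insert _ _))
  have hγ0 : 0 < γ := hg0.trans_le hgγ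
  -- Otherwise all powers of `γ`, the largest value below `1`, would lie in the finite set `T`.
  obtain ⟨k, hk⟩ : ∃ k, γ ^ k ≤ g := by
    by_contra! hcon
    exact Set.infinite_of_injective_forall_mem (pow_right_strictAnti₀ hγ0 hγ1).injective
      (s := T) (fun k => ⟨hcon k, pow_le_one₀ hγ0.le hγ1.le⟩) hT
  -- Applied to the powers of `x`, the pigeonhole lemma makes some positive power of `v x` a power
  -- of `g`. Hence no nonzero element is smaller than all powers of `γ`.
  have hlow : ∀ x ∈ w, x ≠ 0 → ∃ m, γ ^ (m + 1) < v x := by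
    intro x hx hx0
    obtain ⟨i, j, hij, c, hc, heq⟩ := exists_valuation_eq_mul v
      (Nat.lt_succ_self (Module.finrank K L)) (fun k => x ^ (k : ℕ)) fun k => pow_ne_zero _ hx0
    obtain ⟨n, hn⟩ := hzpow c hc
    have hvx0 : 0 < v x := zero_lt_iff.mpr (v.ne_zero_iff.mpr hx0)
    have hvx1 : v x ≤ 1 := (hv x).mpr hx
    have hij' : (i : ℕ) < j := hij
    have h1 : v x ^ ((j : ℕ) - i) = g ^ n := by
      apply mul_right_cancel₀ (pow_ne_zero (i : ℕ) hvx0.ne')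
      rw [← pow_add, Nat.sub_add_cancel hij'.le, ← hn, ← map_pow, ← map_pow, heq]
    refine ⟨k * n.toNat, ?_⟩
    calc γ ^ (k * n.toNat + 1) < γ ^ (k * n.toNat) :=
          pow_right_strictAnti₀ hγ0 hγ1 (Nat.lt_succ_self _)
      _ = (γ ^ k) ^ n.toNat := pow_mul _ _ _
      _ ≤ g ^ n.toNat := pow_le_pow_left' hk _
      _ = g ^ (n.toNat : ℤ) := (zpow_natCast _ _).symm
      _ ≤ g ^ n := zpow_le_zpow_right_of_le_one₀ hg0 hg1.le (Int.self_le_toNat n)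
      _ = v x ^ ((j : ℕ) - i) := h1.symm
      _ ≤ v x ^ 1 := pow_le_pow_right_of_le_one' hvx1 (by omega)
      _ = v x := pow_one _
  obtain ⟨ϖ, hϖ⟩ := w.valuation_surjective γ
  have hϖ0 : ϖ ≠ 0 := fun h => hγ0.ne (by rw [← hϖ, h, map_zero])
  have hϖw : ϖ ∈ w := (hv ϖ).mp (hϖ.trans_le hγ1.le)
  refine IsDiscreteValuationRing.ofHasUnitMulPowIrreducibleFactorization
    ⟨⟨ϖ, hϖw⟩, ⟨?_, ?_⟩, ?_⟩
  · rw [w.valuation_eq_one_iff]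
    exact fun h => hγ1.ne (hϖ.symm.trans h)
  · intro a b hab
    by_contra! hcon
    rw [w.valuation_eq_one_iff, w.valuation_eq_one_iff] at hcon
    have ha := lt_of_le_of_ne (w.valuation_le_one a) hcon.1
    have hb := lt_of_le_of_ne (w.valuation_le_one b) hcon.2
    have h1 : γ = w.valuation a * w.valuation b := by
      rw [← map_mul, ← hϖ]
      exact congrArg w.valuation (congrArg Subtype.val hab)
    have h2 : γ < γ := by
      calc γ = w.valuation a * w.valuation b := h1
        _ ≤ γ * w.valuation b := mul_le_mul' (hγmax _ ha) le_rfl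
        _ < γ * 1 := mul_lt_mul_of_pos_left hb hγ0
        _ = γ := mul_one γ
    exact h2.false
  · rintro ⟨x, hx⟩ hx0
    have hx0' : x ≠ 0 := fun h => hx0 (Subtype.ext h)
    have hex := hlow x hx hx0'
    set n := Nat.find hex with hn
    have hn1 : γ ^ (n + 1) < v x := Nat.find_spec hex
    have hn2 : v x ≤ γ ^ n := by
      rcases Nat.eq_zero_or_pos n with h0 | hpos
      · rw [h0, pow_zero]; exact (hv x).mpr hx
      · have := Nat.find_min hex (Nat.sub_lt hpos one_pos)
        rw [← hn, not_lt] at this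
        rwa [show n - 1 + 1 = n by omega] at this
    have hu : v (x / ϖ ^ n) = 1 := by
      have hpos : 0 < γ ^ n := pow_pos hγ0 n
      rw [map_div₀, map_pow, show v ϖ = γ from hϖ]
      refine le_antisymm (div_le_one_of_le₀ hn2 zero_le) ?_
      by_contra! hlt
      have h1 := hγmax _ hlt
      rw [div_le_iff₀ hpos, ← pow_succ'] at h1
      exact absurd hn1 (not_lt.mpr h1)
    have huw : x / ϖ ^ n ∈ w := (hv _).mp hu.le
    have hunit : IsUnit (⟨x / ϖ ^ n, huw⟩ : w) := (w.valuation_eq_one_iff _).mpr hu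
    refine ⟨n, hunit.unit, Subtype.ext ?_⟩
    change ϖ ^ n * (x / ϖ ^ n) = x
    rw [mul_div_cancel₀ _ (pow_ne_zero n hϖ0)]

open WithZero in
/-- The normalized valuation of `L` restricts to the multiple of the one of `K` by the
ramification index. -/
theorem log_dvrValuation_algebraMap [IsDiscreteValuationRing w] :
    1 ≤ ramificationIndex K w ∧ ∀ c : K, log (dvrValuation w (algebraMap K L c)) =
      ramificationIndex K w * log (dvrValuation (below K w) c) := by
  obtain ⟨π, hπ⟩ := IsDiscreteValuationRing.exists_irreducible (below K w)
  have hv : ∀ y, dvrValuation w y ≤ 1 ↔ y ∈ w := fun y => dvrValuation_le_one_iff w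
  have hπ0 : algebraMap K L (π : K) ≠ 0 :=
    (map_ne_zero _).mpr fun h => hπ.ne_zero (Subtype.ext h)
  have hlt := valuation_uniformizer_lt_one w hπ (dvrValuation w) hv
  have hne := (dvrValuation w).ne_zero_iff.mpr hπ0
  have hlog : log (dvrValuation w (algebraMap K L (π : K))) < 0 := (log_lt_iff_lt_exp hne).mpr hlt
  obtain ⟨N, hN⟩ := Int.eq_ofNat_of_zero_le (neg_nonneg.mpr hlog.le)
  have hvπ : dvrValuation w (algebraMap K L (π : K)) = exp (-(N : ℤ)) := by
    rw [← hN, neg_neg, exp_log hne]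
  have he : ramificationIndex K w = N := by
    let := belowAlgebra K w
    have hmem : ∀ n : ℕ, (IsLocalRing.maximalIdeal (below K w)).map (algebraMap (below K w) w) ≤
        IsLocalRing.maximalIdeal w ^ n ↔ n ≤ N := by
      intro n
      rw [hπ.maximalIdeal_eq, Ideal.map_span, Set.image_singleton, Ideal.span_singleton_le_iff_mem,
        ← dvrValuation_le_exp_iff]
      change dvrValuation w (algebraMap K L (π : K)) ≤ _ ↔ _
      rw [hvπ, exp_le_exp]
      omega
    exact Ideal.ramificationIdx'_spec ((hmem N).mpr le_rfl) fun h => by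
      have := (hmem (N + 1)).mp h
      omega
  rw [he]
  refine ⟨by omega, fun c => ?_⟩
  by_cases hc : c = 0
  · simp [hc]
  · obtain ⟨n, h1, h2⟩ := valuation_algebraMap_zpow w hπ (dvrValuation w) hv hc
    rw [h1, h2, hvπ, dvrValuation_irreducible _ hπ, log_zpow, log_zpow, log_exp, log_exp]
    simp only [smul_eq_mul]
    ring

end

end FiniteExtension

/-! ### Valuation rings with a center of codimension one on a normal Noetherian scheme -/

section Center

variable {K : Type*} [Field K]

theorem mem_center_iff {w : ValuationSubring K} {B : Subring K} {h : B ≤ w.toSubring} {b : B} :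
    b ∈ center w B h ↔ (b : K) = 0 ∨ (b : K)⁻¹ ∉ w := by
  rw [← ValuationSubring.mem_nonunits_iff_or]
  exact (ValuationSubring.coe_mem_nonunits_iff (A := w) (a := ⟨b, h b.2⟩)).symm

instance center_isPrime (w : ValuationSubring K) (B : Subring K) (h : B ≤ w.toSubring) :
    (center w B h).IsPrime :=
  Ideal.IsPrime.comap _

theorem inv_mem_of_notMem_center {w : ValuationSubring K} {B : Subring K} {h : B ≤ w.toSubring}
    {b : B} (hb : b ∉ center w B h) : (b : K)⁻¹ ∈ w := by
  rw [mem_center_iff, not_or, not_not] at hb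
  exact hb.2

/-- A nonzero prime ideal that contains no smaller nonzero prime ideal. -/
def IsMinimalNonzeroPrime {R : Type*} [CommRing R] (p : Ideal R) : Prop :=
  p ≠ ⊥ ∧ ∀ q : Ideal R, q.IsPrime → q ≠ ⊥ → q ≤ p → q = p

variable (R : Subring K) [IsNoetherianRing R] [IsIntegrallyClosed R]

/-- The localization at `p` is a Noetherian integrally closed local domain whose only nonzero prime
is the maximal ideal. -/
theorem isPrincipalIdealRing_ofPrime {p : Ideal R} [p.IsPrime] (hp : IsMinimalNonzeroPrime p) :
    IsPrincipalIdealRing (LocalSubring.ofPrime R p).toSubring := by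
  let O := (LocalSubring.ofPrime R p).toSubring
  have hloc : IsLocalization.AtPrime O p := inferInstance
  have : IsLocalRing O := IsLocalization.AtPrime.isLocalRing O p
  have : IsNoetherianRing O := IsLocalization.isNoetherianRing p.primeCompl O inferInstance
  have : IsIntegrallyClosed O :=
    isIntegrallyClosed_of_isLocalization _ p.primeCompl p.primeCompl_le_nonZeroDivisors
  have htfae : IsPrincipalIdealRing O ↔ IsIntegrallyClosed O ∧
      ∀ P : Ideal O, P ≠ ⊥ → P.IsPrime → P = IsLocalRing.maximalIdeal O :=
    (tfae_of_isNoetherianRing_of_isLocalRing_of_isDomain O).out 0 3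
  refine htfae.mpr ⟨inferInstance, fun P hP hPp => ?_⟩
  let e := IsLocalization.AtPrime.orderIsoOfPrime O p
  have h1 : (e ⟨P, hPp⟩).1 = p := by
    refine hp.2 _ (e ⟨P, hPp⟩).2.1 (fun h0 => hP ?_) (e ⟨P, hPp⟩).2.2
    have h2 : P.comap (algebraMap R O) = ⊥ := h0
    rw [← IsLocalization.map_under p.primeCompl O P]
    change Ideal.map (algebraMap R O) (P.comap (algebraMap R O)) = ⊥
    rw [h2, Ideal.map_bot]
  have h3 : (e ⟨IsLocalRing.maximalIdeal O, inferInstance⟩).1 = p :=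
    IsLocalization.AtPrime.under_maximalIdeal O p
  exact congrArg Subtype.val (e.injective (Subtype.ext (h1.trans h3.symm)))

variable [IsFractionRing R K]

/-- The localization is a valuation ring inside `v`. If `x ∈ v` and `x⁻¹ = a / b` lies in it, then
`a` is outside the center, so `x` lies in it too. In particular `v` is determined by its center. -/
theorem toSubring_eq_ofPrime_center {v : ValuationSubring K} {h : R ≤ v.toSubring}
    (hp : IsMinimalNonzeroPrime (center v R h)) :
    v.toSubring = (LocalSubring.ofPrime R (center v R h)).toSubring := by
  set p := center v R h with hpdef
  let O := (LocalSubring.ofPrime R p).toSubring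
  have : IsPrincipalIdealRing O := isPrincipalIdealRing_ofPrime R hp
  have hloc : IsLocalization.AtPrime O p := inferInstance
  have : IsLocalRing O := IsLocalization.AtPrime.isLocalRing O p
  have : IsNoetherianRing O := IsLocalization.isNoetherianRing p.primeCompl O inferInstance
  have : ValuationRing O := ((tfae_of_isNoetherianRing_of_isLocalRing_of_isDomain O).out 0 1).mp
    ‹_›
  have : IsFractionRing O K :=
    IsFractionRing.isFractionRing_of_isDomain_of_isLocalization p.primeCompl O K
  have hform : ∀ x ∈ O, ∃ a b : R, b ∉ p ∧ x * b = a := fun x hx => by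
    obtain ⟨⟨a, b⟩, hab⟩ := IsLocalization.surj p.primeCompl (⟨x, hx⟩ : O)
    exact ⟨a, b, b.2, congrArg Subtype.val hab⟩
  have hOv : ∀ x ∈ O, x ∈ v := fun x hx => by
    obtain ⟨a, b, hb, hab⟩ := hform x hx
    have hb0 : (b : K) ≠ 0 := fun h0 => hb (mem_center_iff.mpr (Or.inl h0))
    rw [eq_div_of_mul_eq hb0 hab, div_eq_mul_inv]
    exact v.mul_mem _ _ (h a.2) (inv_mem_of_notMem_center hb)
  have hinv : ∀ b : R, b ∉ p → (b : K)⁻¹ ∈ O := fun b hb => by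
    obtain ⟨c, hc⟩ := isUnit_iff_exists_inv.mp (IsLocalization.map_units O (⟨b, hb⟩ : p.primeCompl))
    have h1 : (b : K) * (c : K) = 1 := congrArg Subtype.val hc
    rw [inv_eq_of_mul_eq_one_right h1]
    exact c.2
  refine le_antisymm (fun x hx => ?_) hOv
  rcases ValuationRing.isInteger_or_isInteger (R := O) x with ⟨y, hy⟩ | ⟨y, hy⟩
  · exact hy ▸ y.2
  · have hyO : x⁻¹ ∈ O := hy ▸ y.2
    by_cases hx0 : x = 0
    · exact hx0 ▸ O.zero_mem
    obtain ⟨a, b, hb, hab⟩ := hform _ hyO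
    have hb0 : (b : K) ≠ 0 := fun h0 => hb (mem_center_iff.mpr (Or.inl h0))
    have ha : a ∉ p := fun ha => by
      rcases mem_center_iff.mp ha with h0 | h0
      · rw [h0] at hab
        exact mul_ne_zero (inv_ne_zero hx0) hb0 hab
      · rw [← hab, mul_inv, inv_inv] at h0
        exact h0 (v.mul_mem _ _ hx (inv_mem_of_notMem_center hb))
    have hxe : x = b * (a : K)⁻¹ := by
      rw [← hab]; field_simp
    rw [hxe]
    exact O.mul_mem (LocalSubring.le_ofPrime R p b.2) (hinv a ha)

theorem isDiscreteValuationRing_of_center {v : ValuationSubring K} {h : R ≤ v.toSubring}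
    (hp : IsMinimalNonzeroPrime (center v R h)) : IsDiscreteValuationRing v := by
  have hO := isPrincipalIdealRing_ofPrime R hp
  have heq := toSubring_eq_ofPrime_center R hp
  have : IsPrincipalIdealRing v := hO.of_surjective
    (Subring.inclusion heq.ge : _ →+* v.toSubring) fun y => ⟨⟨y, heq.le y.2⟩, rfl⟩
  refine { not_a_field' := fun h0 => hp.1 ?_ }
  rw [eq_bot_iff]
  intro b hb
  have h1 : (⟨b, h b.2⟩ : v) ∈ IsLocalRing.maximalIdeal v := hb
  rw [h0, Ideal.mem_bot] at h1
  exact Subtype.ext (show (b : K) = 0 from congrArg Subtype.val h1)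

/-- Only finitely many minimal nonzero primes are centers of places where `c` is not a unit. -/
theorem finite_setOf_nonunit {c : K} (hc : c ≠ 0) :
    {v : ValuationSubring K | ¬ (c ∈ v ∧ c⁻¹ ∈ v) ∧
      ∃ h : R ≤ v.toSubring, IsMinimalNonzeroPrime (center v R h)}.Finite := by
  -- If neither `a` nor `b` is in the center, `c = a / b` is a unit at `v`. Otherwise the center is
  -- a minimal prime over `(a)` or `(b)`, and there are finitely many of these.
  obtain ⟨a, b, hb, hab⟩ := IsFractionRing.div_surjective (A := R) c
  have hb0 : b ≠ 0 := nonZeroDivisors.ne_zero hb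
  have ha0 : a ≠ 0 := fun h0 => hc (by rw [← hab, h0, map_zero, zero_div])
  let f : ValuationSubring K → Ideal R := fun v => by
    classical exact if h : R ≤ v.toSubring then center v R h else ⊥
  have hf : ∀ v (h : R ≤ v.toSubring), f v = center v R h := fun v h => dif_pos h
  have hfin : ((Ideal.span {a}).minimalPrimes ∪ (Ideal.span {b}).minimalPrimes).Finite :=
    (Ideal.finite_minimalPrimes_of_isNoetherianRing R _).union
      (Ideal.finite_minimalPrimes_of_isNoetherianRing R _)
  have hmin : ∀ (p : Ideal R) [p.IsPrime], IsMinimalNonzeroPrime p → ∀ d : R, d ≠ 0 → d ∈ p →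
      p ∈ (Ideal.span {d}).minimalPrimes := fun p _ hp d hd hdp => by
    refine ⟨⟨inferInstance, (Ideal.span_singleton_le_iff_mem _).mpr hdp⟩, fun q hq hqp => ?_⟩
    refine (hp.2 q hq.1 (fun h0 => hd ?_) hqp).ge
    have := (Ideal.span_singleton_le_iff_mem _).mp hq.2
    rwa [h0, Ideal.mem_bot] at this
  refine Set.Finite.of_finite_image (f := f) (hfin.subset ?_) ?_
  · rintro _ ⟨v, ⟨hv, h, hp⟩, rfl⟩
    rw [hf v h]
    by_cases hac : a ∈ center v R h
    · exact Or.inl (hmin _ hp a ha0 hac)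
    · by_cases hbc : b ∈ center v R h
      · exact Or.inr (hmin _ hp b hb0 hbc)
      · refine absurd ⟨?_, ?_⟩ hv
        · rw [← hab, div_eq_mul_inv]
          exact v.mul_mem _ _ (h a.2) (inv_mem_of_notMem_center hbc)
        · rw [← hab, inv_div, div_eq_mul_inv]
          exact v.mul_mem _ _ (h b.2) (inv_mem_of_notMem_center hac)
  · rintro v ⟨-, h, hp⟩ v' ⟨-, h', hp'⟩ heq
    rw [hf v h, hf v' h'] at heq
    apply ValuationSubring.toSubring_injective
    rw [toSubring_eq_ofPrime_center R hp, toSubring_eq_ofPrime_center R hp']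
    congr 1
    simp only [heq]

end Center

/-! ### Centers of height one under integral extensions -/

section GoingDown

variable {K : Type*} [Field K] {L : Type*} [Field L] [Algebra K L]

/-- Over a normal ring, primes of height one of an integral extension lie over minimal nonzero
primes. -/
theorem isMinimalNonzeroPrime_under {R B : Type*} [CommRing R] [CommRing B] [IsDomain B]
    [Algebra R B] [FaithfulSMul R B] [Algebra.IsIntegral R B] [IsIntegrallyClosed R]
    (P : Ideal B) [P.IsPrime] (hP : P.height = 1) : IsMinimalNonzeroPrime (P.under R) := by
  have : IsDomain R := (FaithfulSMul.algebraMap_injective R B).isDomain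
  refine ⟨fun h0 => P.ne_bot_of_height_eq_one hP (Ideal.eq_bot_of_comap_eq_bot h0),
    fun q hq hq0 hqP => ?_⟩
  by_contra hne
  -- Going down, available since `R` is integrally closed: a smaller nonzero prime below would lift
  -- to a prime strictly inside `P`, which height one forces to be zero.
  obtain ⟨Q, hQP, hQ, hQq⟩ :=
    Ideal.exists_ideal_lt_liesOver_of_lt P (lt_of_le_of_ne hqP hne)
  have h1 := Ideal.height_add_one_le_of_lt_of_isPrime hQP
  have h2 : Q.height = 0 := by
    rw [hP] at h1
    by_contra h3
    have h4 : 1 ≤ Q.height := Order.one_le_iff_pos.mpr (pos_iff_ne_zero.mpr h3)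
    have h5 : (1 : ℕ∞) + 1 ≤ 1 := (add_le_add_left h4 1).trans h1
    exact absurd h5 (by decide)
  rw [Ideal.height_eq_zero_iff_eq_bot] at h2
  apply hq0
  rw [hQq.over, h2, Ideal.under, ← RingHom.ker_eq_comap_bot,
    (RingHom.injective_iff_ker_eq_bot _).mp (FaithfulSMul.algebraMap_injective R B)]

theorem isMinimalNonzeroPrime_center_below {R : Subring K} [IsIntegrallyClosed R] {B : Subring L}
    (hB : ∀ y : L, y ∈ B ↔ IsIntegral R y) {w : ValuationSubring L} (h : B ≤ w.toSubring)
    (hw : (center w B h).height = 1) :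
    ∃ h' : R ≤ (below K w).toSubring, IsMinimalNonzeroPrime (center (below K w) R h') := by
  have hRB : ∀ r : R, algebraMap K L r ∈ B := fun r =>
    (hB _).mpr (isIntegral_algebraMap (R := R) (A := L) (x := r))
  let g : R →+* B := ((algebraMap K L).comp R.subtype).codRestrict B hRB
  let : Algebra R B := g.toAlgebra
  have : IsScalarTower R B L := .of_algebraMap_eq fun _ => rfl
  have hinj : Function.Injective g := fun x y hxy =>
    Subtype.ext ((algebraMap K L).injective (congrArg Subtype.val hxy))
  have : FaithfulSMul R B := (faithfulSMul_iff_algebraMap_injective R B).mpr hinj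
  have : Algebra.IsIntegral R B := ⟨fun b =>
    ((hB b).mp b.2).tower_bot (A := B) (B := L) Subtype.val_injective⟩
  have hR : R ≤ (below K w).toSubring := fun r hr => h (hRB ⟨r, hr⟩)
  refine ⟨hR, ?_⟩
  convert isMinimalNonzeroPrime_under (R := R) (center w B h) hw using 1
  ext r
  rw [mem_center_iff, Ideal.under, Ideal.mem_comap, mem_center_iff]
  refine or_congr ?_ (not_congr ?_)
  · exact (map_eq_zero (algebraMap K L)).symm
  · rw [mem_below_iff, map_inv₀]
    rfl

end GoingDown

/-! ### Prime divisors of the projective model -/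

namespace ProjectiveModel

variable {k : Type*} [Field k] {K : Type*} [Field K] [Algebra k K] {M : ℕ}
  (V : ProjectiveModel k K M)

theorem isNoetherianRing_chart (j : Fin (M + 1)) :
    IsNoetherianRing (chart k V.coord j).toSubring :=
  isNoetherianRing_of_fg (Subalgebra.fg_def.mpr ⟨_, Set.finite_range _, rfl⟩)

/-- Every ratio of coordinates is a quotient of two ratios over `V.coord j`, so one chart already
generates `K`. -/
theorem isFractionRing_chart {j : Fin (M + 1)} (hj : V.coord j ≠ 0) :
    IsFractionRing (chart k V.coord j).toSubring K := by
  have hle : IntermediateField.adjoin k {y : K | ∃ i j, y = V.coord i / V.coord j} ≤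
      IntermediateField.adjoin k (Set.range fun i => V.coord i / V.coord j) := by
    rw [IntermediateField.adjoin_le_iff]
    rintro _ ⟨i, l, rfl⟩
    rw [← div_div_div_cancel_right₀ hj]
    exact div_mem (IntermediateField.subset_adjoin _ _ ⟨i, rfl⟩)
      (IntermediateField.subset_adjoin _ _ ⟨l, rfl⟩)
  rw [V.generates] at hle
  refine IsFractionRing.of_field _ _ fun z => ?_
  obtain ⟨r, hr, s, hs, h⟩ := IntermediateField.mem_adjoin_iff_div.mp
    (hle (IntermediateField.mem_top (x := z)))
  exact ⟨⟨r, hr⟩, ⟨s, hs⟩, h⟩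

/-- The valuation ring `v` of `K` has a center of codimension one on `V`. -/
def IsPrimeDivisor (v : ValuationSubring K) : Prop :=
  ∃ j, V.coord j ≠ 0 ∧ ∃ h : (chart k V.coord j).toSubring ≤ v.toSubring,
    IsMinimalNonzeroPrime (center v _ h)

theorem isDiscreteValuationRing_of_isPrimeDivisor {v : ValuationSubring K}
    (hv : V.IsPrimeDivisor v) : IsDiscreteValuationRing v := by
  obtain ⟨j, hj, h, hp⟩ := hv
  have := V.isNoetherianRing_chart j
  have : IsIntegrallyClosed (chart k V.coord j).toSubring := V.normal j hj
  have := V.isFractionRing_chart hj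
  exact isDiscreteValuationRing_of_center _ hp

/-- An element of `K` is a unit at all but finitely many divisors. -/
theorem finite_setOf_isPrimeDivisor_nonunit {c : K} (hc : c ≠ 0) :
    {v | V.IsPrimeDivisor v ∧ ¬ (c ∈ v ∧ c⁻¹ ∈ v)}.Finite := by
  refine Set.Finite.subset (s := ⋃ j : {j // V.coord j ≠ 0}, {v : ValuationSubring K |
    ¬ (c ∈ v ∧ c⁻¹ ∈ v) ∧ ∃ h : (chart k V.coord j).toSubring ≤ v.toSubring,
      IsMinimalNonzeroPrime (center v _ h)}) (Set.finite_iUnion fun j => ?_) ?_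
  · have := V.isNoetherianRing_chart j
    have : IsIntegrallyClosed (chart k V.coord j).toSubring := V.normal j j.2
    have := V.isFractionRing_chart j.2
    exact finite_setOf_nonunit _ hc
  · rintro v ⟨⟨j, hj, h⟩, hv⟩
    exact Set.mem_iUnion.mpr ⟨⟨j, hj⟩, hv, h⟩

theorem isPrimeDivisor_below {L : Type*} [Field L] [Algebra K L] {w : ValuationSubring L}
    (hw : w ∈ V.divisors L) : V.IsPrimeDivisor (below K w) := by
  obtain ⟨j, hj, h, hh⟩ := hw
  have : IsIntegrallyClosed (chart k V.coord j).toSubring := V.normal j hj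
  exact ⟨j, hj, isMinimalNonzeroPrime_center_below (R := (chart k V.coord j).toSubring)
    (fun y => Iff.rfl) h hh⟩

open WithZero in
/-- The valuations of finitely many elements of `K` at the divisors of `V` are bounded. -/
theorem exists_abs_log_le (T : Finset K) :
    ∃ E : ℕ, ∀ (v : ValuationSubring K) [IsDiscreteValuationRing v], V.IsPrimeDivisor v →
      ∀ c ∈ T, |log (dvrValuation v c)| ≤ E := by
  classical
  have hfin : {v | V.IsPrimeDivisor v ∧ ∃ c ∈ T, c ≠ 0 ∧ ¬ (c ∈ v ∧ c⁻¹ ∈ v)}.Finite := by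
    refine Set.Finite.subset (s := ⋃ c : {c // c ∈ T ∧ c ≠ 0},
      {v | V.IsPrimeDivisor v ∧ ¬ (c.1 ∈ v ∧ c.1⁻¹ ∈ v)}) ?_ ?_
    · have : Finite {c // c ∈ T ∧ c ≠ 0} := (T.finite_toSet.subset fun c hc => hc.1).to_subtype
      exact Set.finite_iUnion fun c => V.finite_setOf_isPrimeDivisor_nonunit c.2.2
    · rintro v ⟨hv, c, hcT, hc0, hc⟩
      exact Set.mem_iUnion.mpr ⟨⟨c, hcT, hc0⟩, hv, hc⟩
  let N : ValuationSubring K → K → ℕ := fun v c =>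
    if h : IsDiscreteValuationRing v then (log (dvrValuation v c)).natAbs else 0
  -- At all other divisors each element of `T` is `0` or a unit and has `log` equal to `0`, by
  -- convention in the first case. The sum of the absolute values at the exceptional divisors bounds
  -- each of them.
  refine ⟨∑ v ∈ hfin.toFinset, ∑ c ∈ T, N v c, fun v hd hv c hc => ?_⟩
  by_cases hvc : c ≠ 0 ∧ ¬ (c ∈ v ∧ c⁻¹ ∈ v)
  · have hmem : v ∈ hfin.toFinset := hfin.mem_toFinset.mpr ⟨hv, c, hc, hvc⟩
    have h1 : N v c ≤ ∑ v ∈ hfin.toFinset, ∑ c ∈ T, N v c :=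
      (Finset.single_le_sum (f := N v) (fun _ _ => Nat.zero_le _) hc).trans
        (Finset.single_le_sum (f := fun v => ∑ c ∈ T, N v c) (fun _ _ => Nat.zero_le _) hmem)
    have h2 : N v c = (log (dvrValuation v c)).natAbs := dif_pos hd
    rw [h2] at h1
    rw [Int.abs_eq_natAbs]
    exact_mod_cast h1
  · have h0 : log (dvrValuation v c) = 0 := by
      by_cases hc0 : c = 0
      · rw [hc0, map_zero, log_zero]
      · have h1 : c ∈ v ∧ c⁻¹ ∈ v := by_contra fun h => hvc ⟨hc0, h⟩
        rw [dvrValuation_unit v hc0 h1.1 h1.2, log_one]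
    rw [h0, abs_zero]
    exact Int.natCast_nonneg _

end ProjectiveModel

/-! ### Assembly of the uniform bound -/

open WithZero in
/-- At a divisor `w` of the normalization of `V` in a finite extension, the truncated order comes
from a discrete valuation, and a bound for the orders of elements of `K` at the divisors of `V`
holds at `w` up to the ramification index. -/
theorem ProjectiveModel.exists_valuation {k : Type*} [Field k] {K : Type*} [Field K] [Algebra k K]
    {M : ℕ} (V : ProjectiveModel k K M) {L : Type*} [Field L] [Algebra K L]
    [FiniteDimensional K L] {w : ValuationSubring L} (hw : w ∈ V.divisors L) {T : Set K} {E : ℕ}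
    (hE : ∀ (v : ValuationSubring K) [IsDiscreteValuationRing v], V.IsPrimeDivisor v →
      ∀ c ∈ T, |log (dvrValuation v c)| ≤ E) :
    1 ≤ ramificationIndex K w ∧ ∃ v : Valuation L (WithZero (Multiplicative ℤ)),
      (∀ y, truncatedOrd w y = -logPlus v y) ∧
      ∀ c ∈ T, |log (v (algebraMap K L c))| ≤ E * ramificationIndex K w := by
  have hdiv := V.isPrimeDivisor_below hw
  have := V.isDiscreteValuationRing_of_isPrimeDivisor hdiv
  have : IsDiscreteValuationRing w := isDiscreteValuationRing_of_below (K := K) w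
  obtain ⟨he, hlog⟩ := log_dvrValuation_algebraMap (K := K) w
  refine ⟨he, dvrValuation w, truncatedOrd_eq w, fun c hc => ?_⟩
  rw [hlog, abs_mul, Nat.abs_cast, mul_comm]
  exact mul_le_mul_of_nonneg_right (hE _ hdiv c hc) (Int.natCast_nonneg _)

/-- The lower bound for local heights without the weights `deg(v) f(w|v) / [L : K]`. -/
theorem DrinfeldModule.exists_div_pow_le_neg_unweightedLocalHeight {Fq : Type*} [Field Fq]
    [Finite Fq] {A : Type*} [CommRing A] [IsDomain A] [Algebra Fq A] {k : Type*} [Field k]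
    {K : Type*} [Field K] [Algebra Fq K] [Algebra k K] {M : ℕ} (V : ProjectiveModel k K M)
    {i : A →ₐ[Fq] K} (φ : DrinfeldModule Fq i) (hφ : RingHom.ker i ≠ ⊥)
    (hdep : ∀ a s : A, ¬ AlgebraicIndependent Fq ![a, s]) :
    ∃ C : ℝ, 0 < C ∧ ∃ m : ℕ, ∀ a : A, ¬ IsAlgebraic Fq a →
      ∀ (L : Type*) [Field L] [Algebra K L] [FiniteDimensional K L],
      ∀ w ∈ V.divisors L, 1 ≤ ramificationIndex K w ∧
        ∀ x : L, 0 < -φ.unweightedLocalHeight a w x →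
          C / (ramificationIndex K w : ℝ) ^ m ≤ -φ.unweightedLocalHeight a w x := by
  classical
  obtain ⟨t, hit, ht⟩ := Submodule.exists_mem_ne_zero_of_ne_bot hφ
  have hit : i t = 0 := hit
  set T : Finset K := (φ.toRingHom t).support.image (φ.toRingHom t).coeff with hT
  obtain ⟨E, hE⟩ := V.exists_abs_log_le T
  by_cases hinj : Function.Injective φ.toRingHom
  · refine ⟨(((Nat.card Fq : ℝ) ^ 3 * (E * (2 * (φ.toRingHom t).degree + 2) + 1)) ^
        ((φ.toRingHom t).support.sup id * (((φ.toRingHom t).support ×ˢ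
          (φ.toRingHom t).support).card * (φ.toRingHom t).support.sup id + 1)))⁻¹, ?_,
      (φ.toRingHom t).support.sup id * (((φ.toRingHom t).support ×ˢ
          (φ.toRingHom t).support).card * (φ.toRingHom t).support.sup id + 1), ?_⟩
    · have : 0 < (Nat.card Fq : ℝ) := Nat.cast_pos.mpr Nat.card_pos
      positivity
    · intro a ha L _ _ _ w hw
      obtain ⟨he, v, hv, hlog⟩ := V.exists_valuation hw (T := T) hE
      refine ⟨he, fun x hx => ?_⟩
      let : Algebra Fq L := ((algebraMap K L).comp (algebraMap Fq K)).toAlgebra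
      have : IsScalarTower Fq K L := .of_algebraMap_eq fun _ => rfl
      refine φ.div_pow_le_neg_unweightedLocalHeight hinj ht hit hv he (fun j => ?_) ha hx
      by_cases hj : j ∈ (φ.toRingHom t).support
      · exact hlog _ (Finset.mem_image_of_mem _ hj)
      · rw [TwistedPoly.mem_support_iff, not_not] at hj
        rw [hj, map_zero, map_zero, WithZero.log_zero, abs_zero]
        positivity
  -- The structure `DrinfeldModule` admits noninjective `φ`. The unweighted height is then an
  -- integer, so a positive one is at least `1`, and `C = 1` with exponent `0` works.
  · rw [injective_iff_map_eq_zero] at hinj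
    push Not at hinj
    obtain ⟨s, hφs, hs⟩ := hinj
    refine ⟨1, one_pos, 0, fun a _ L _ _ _ w hw => ?_⟩
    obtain ⟨he, v, hv, -⟩ := V.exists_valuation hw (T := T) hE
    refine ⟨he, fun x hx => ?_⟩
    obtain ⟨n, hn⟩ := φ.unweightedLocalHeight_of_degenerate hv
      (φ.eq_zero_or_pow_eq_one hs hφs (hdep a s)) x
    rw [hn] at hx ⊢
    rw [pow_zero, div_one]
    norm_cast at hx ⊢

/-- Two elements of an algebra that embeds into a field of transcendence degree one are
algebraically dependent. -/
theorem not_algebraicIndependent_pair {R A F : Type*} [Field R] [CommRing A] [Algebra R A]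
    [Field F] [Algebra R F] (hF : Algebra.trdeg R F = 1) (g : A →ₐ[R] F)
    (hg : Function.Injective g) (a s : A) : ¬ AlgebraicIndependent R ![a, s] := by
  intro h
  have h1 := (h.map' hg).lift_cardinalMk_le_trdeg
  rw [hF] at h1
  simp at h1

end DrinfeldHeight

open DrinfeldHeight in
theorem theoremT
    -- the finite field with `q` elements, and a curve over it with function field `F`
    (Fq : Type*) [Field Fq] [Finite Fq]
    (F : Type*) [Field F] [Algebra Fq F] [Algebra.EssFiniteType Fq F]
    (hF : Algebra.trdeg Fq F = 1)
    -- a closed point of the curve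
    (infty : ValuationSubring F) (hinfty : infty ≠ ⊤)
    -- a normal projective variety over a finite extension `k` of `Fq`, with function field `K`
    (k : Type*) [Field k] [Finite k] [Algebra Fq k]
    (K : Type*) [Field K] [Algebra Fq K] [Algebra k K] [IsScalarTower Fq k K]
    (M : ℕ) (V : ProjectiveModel k K M)
    -- a Drinfeld module of finite characteristic
    (i : regularAwayFrom Fq infty →ₐ[Fq] K) (φ : DrinfeldModule Fq i)
    (hφ : RingHom.ker i ≠ ⊥) :
    ∃ C : ℝ, 0 < C ∧ ∃ κ : ℝ, 1 ≤ κ ∧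
      -- the local height does not depend on the nonconstant element `a` used to define it
      ∀ a : regularAwayFrom Fq infty, ¬ IsAlgebraic Fq a →
      ∀ x : AlgebraicClosure K,
      ∀ v ∈ V.divisors (IntermediateField.adjoin K {x}),
        0 < φ.localHeight a V v (IntermediateField.AdjoinSimple.gen K x) →
        C / ((ramificationIndex K v : ℝ) ^ (κ - 1) *
            (Module.finrank K (IntermediateField.adjoin K {x}) : ℝ)) ≤
          φ.localHeight a V v (IntermediateField.AdjoinSimple.gen K x) := by
  obtain ⟨C, hC, m, hCm⟩ := φ.exists_div_pow_le_neg_unweightedLocalHeight V hφ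
    (not_algebraicIndependent_pair hF (regularAwayFrom Fq infty).val Subtype.val_injective)
  -- The exponent `m` of the ramification index is `κ - 1`.
  refine ⟨C, hC, m + 1, by simp, fun a ha x v hv hpos => ?_⟩
  have : FiniteDimensional K (IntermediateField.adjoin K {x}) :=
    IntermediateField.adjoin.finiteDimensional (Algebra.IsIntegral.isIntegral x)
  obtain ⟨he, hbound⟩ := hCm a ha _ v hv
  have hd : (0 : ℝ) < Module.finrank K (IntermediateField.adjoin K {x}) :=
    Nat.cast_pos.mpr Module.finrank_pos
  rw [DrinfeldModule.localHeight, neg_mul_comm] at hpos ⊢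
  rw [add_sub_cancel_right, Real.rpow_natCast]
  set g := IntermediateField.AdjoinSimple.gen K x
  set H := -φ.unweightedLocalHeight a v g with hH
  have hweight : (0 : ℝ) ≤ (V.degree (below K v) : ℝ) * (residueDegree K v : ℝ) := by positivity
  have hHpos : 0 < H := pos_of_mul_pos_right hpos (div_nonneg hweight hd.le)
  -- The degree of the divisor and the residue degree are natural numbers. A positive local height
  -- excludes the value `0`, so the weight is at least `1 / d` and neither number has to be
  -- computed.
  have hone : (1 : ℝ) ≤ (V.degree (below K v) : ℝ) * (residueDegree K v : ℝ) := by
    have h0 : (V.degree (below K v) : ℝ) * (residueDegree K v : ℝ) ≠ 0 := fun h0 => by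
      rw [h0, zero_div, zero_mul] at hpos
      exact hpos.false
    norm_cast at h0 ⊢
    exact Nat.one_le_iff_ne_zero.mpr h0
  calc C / ((ramificationIndex K v : ℝ) ^ m * Module.finrank K (IntermediateField.adjoin K {x}))
      = 1 / Module.finrank K (IntermediateField.adjoin K {x}) *
        (C / (ramificationIndex K v : ℝ) ^ m) := by rw [div_mul_div_comm, one_mul, mul_comm (_ ^ m)]
    _ ≤ _ := mul_le_mul (div_le_div_of_nonneg_right hone hd.le) (hbound g hHpos) (by positivity)
        (div_nonneg hweight hd.le)
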